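/- **Setting.** Consider a call-by-value, simply typed $\lambda$-calculus with base types $\mathsf{bool},\mathsf{int},\mathsf{unit}$ (with constants and typed, possibly partial, operations on them), $n$-ary tuples, recursive functions $\lambda^f x.e$ annotated with their types, local references holding arbitrary values (locations are not values), and abstract function names $\alpha_{T\to T'}$. A *configuration* is either the special $\bot$ or a tuple $\langle A;\Gamma;K;s;\hat e\rangle$, where $A$ is a set of abstract names, $\Gamma$ a finite partial map from indices $i\in\mathbb N$ to values, $K$ a stack of evaluation contexts with typed hole, $s$ a store, and $\hat e$ an expression or "$\cdot$" (none). It is *well-formed* when $A$ is finite, contains all its abstract names, and all components are closed and well typed with respect to the typing of $s$. An *ultimate pattern* of a value $v$ is a pair $(D,\Gamma')$ where $D$ is $v$ with each function replaced by a hole with a distinct index and $\Gamma'$ maps exactly these indices to the replaced functions. The transitions are: * $\langle A;\Gamma;K;s;E[\alpha\,v]\rangle\xrightarrow{\mathsf{papp}(\alpha,D)}\langle A;\Gamma,\Gamma';E,K;s;\cdot\rangle$ and $\langle A;\Gamma;K;s;v\rangle\xrightarrow{\mathsf{pret}(D)}\langle A;\Gamma,\Gamma';K;s;\cdot\rangle$,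 for $(D,\Gamma')$ an ultimate pattern of $v$ with $\mathrm{dom}\,\Gamma'\cap\mathrm{dom}\,\Gamma=\emptyset$; * $\langle A;\Gamma;K;s;\cdot\rangle\xrightarrow{\mathsf{oapp}(i,u)}\langle A\uplus\vec\alpha;\Gamma;K;s;e\rangle$, for $\Gamma(i)$ of type $T\to T'$, where $e=\alpha\,u$ if $\Gamma(i)=\alpha$ and $e$ is the $\beta$-reduct of $\Gamma(i)\,u$ if $\Gamma(i)$ is a $\lambda$-abstraction; and $\langle A;\Gamma;E[\cdot]_T,K;s;\cdot\rangle\xrightarrow{\mathsf{oret}(u)}\langle A\uplus\vec\alpha;\Gamma;K;s;E[u]\rangle$; here $u$ is a value of type $T$ built from constants, tuples and pairwise distinct abstract names $\vec\alpha\notin A$; * $\langle A;\Gamma;K;s;e\rangle\xrightarrow{\tau}\langle A;\Gamma;K;s';e'\rangle$ if $(s,e)$ reduces to $(s',e')$; * $C\xrightarrow{\eta}\bot$ for every configuration $C$ and label $\eta\neq\mathsf{term}$; and $\langle A;\Gamma;\varepsilon;s;\cdot\rangle\xrightarrow{\mathsf{term}}\bot$. Let $\stackrel{\tau}{\Rightarrow}$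 be $\xrightarrow{\tau}{}^*$ and, for $\eta\ne\tau$, $\stackrel{\eta}{\Rightarrow}$ be $\xrightarrow{\tau}{}^*\xrightarrow{\eta}\xrightarrow{\tau}{}^*$. For a relation $R$ on configurations, let $\mathrm{WP}(R)$ relate $C_1$ to $C_2$ when for all $C_1\xrightarrow{\eta}C_1'$ there is $C_2'$ with $C_2\stackrel{\eta}{\Rightarrow}C_2'$ and $C_1'\,R\,C_2'$. $R$ is a *weak simulation* if $R\subseteq \mathrm{WP}(R)$ and a *weak simulation up to $f$* if $R\subseteq \mathrm{WP}(f(R))$; *similarity* $\precsim$ is the largest weak simulation. A function $f$ on relations is a *sound up-to technique* if every weak simulation up to $f$ is contained in $\precsim$. The *companion* $t$ is the pointwise union of all monotone $f$ with $f(\mathrm{WP}(R))\subseteq \mathrm{WP}(f(R))$ for all $R$. Write $f\sqsubseteq g$ for pointwise inclusion, and $f^\omega=\bigsqcup_{n<\omega}f^n$. **Separation.** For well-formed $C_j=\langle A_j;\Gamma_j;K_j;s_j;\hat e_j\rangle$ ($j=1,2$) with $\mathrm{dom}\,\Gamma_1\cap\mathrm{dom}\,\Gamma_2=\emptyset$ and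 $\mathrm{dom}\,s_1\cap\mathrm{dom}\,s_2=\emptyset$, for $i\in\{1,2\}$ such that $\hat e_{3-i}=\cdot$, and for a sequence $\vec k$ over $\{1,2\}$ with $|K_1|$ ones and $|K_2|$ twos, let $$C_1\ast^i_{\vec k}C_2=\langle A_1\cup A_2;\Gamma_1,\Gamma_2;K_1\parallel_{\vec k}K_2;s_1,s_2;\hat e_i\rangle,$$ where $K_1\parallel_{\vec k}K_2$ interleaves the stacks, taking the next frame from $K_1$ or $K_2$ as told by $\vec k$. The *up-to-separation* function $\mathsf{sep}$ sends $R$ to the relation consisting of * $(C_1\ast^i_{\vec k}C_3,\;C_2\ast^i_{\vec k}C_4)$, whenever $C_1\,R\,C_2$, $C_3\,R\,C_4$, both conjunctions are defined, the environments of $C_1,C_2$ have the same domain, those of $C_3,C_4$ have the same domain, and the name sets satisfy $A_2\subseteq A_1$ and $A_4\subseteq A_3$; * $(C_1\ast^i_{\vec k}C_3,\;\bot)$, whenever the conjunction is defined and either $C_1\,R\,\bot$ and $C_3\,R\,C_4$ for some $C_4$, or $C_1\,R\,C_2$ for some $C_2$ and $C_3\,R\,\bot$. **Lemma (soundness of up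 to separation).** The function $\mathsf{sep}$ is monotone and is a sound up-to technique: every weak simulation up to $\mathsf{sep}$ is contained in $\precsim$. Moreover, $R\mapsto R\cup\mathsf{sep}(R)$ is a sound up-to technique; $\mathsf{sep}\sqsubseteq t$; and for every $g\sqsubseteq t$ the function $(\mathsf{sep}\sqcup g)^\omega$ is a sound up-to technique. -/

import Mathlib

namespace SepUpTo

/-! ### Types, constants, operations -/

/-- Base types. -/
inductive Base : Type
  | bool
  | int
  | unit

/-- Types: base types, function types, and products of arbitrary length. -/
inductive Ty : Type
  | base (b : Base)
  | arr (T T' : Ty)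
  | prod (Ts : List Ty)

/-- Constants of base type. -/
inductive Const : Type
  | bool (b : Bool)
  | int (n : ℤ)
  | unit

/-- The type of a constant. -/
def Const.ty : Const → Base
  | .bool _ => .bool
  | .int _ => .int
  | .unit => .unit

/-- The arithmetic operations of the language: each has an arity (argument and result base types)
and a possibly partial interpretation on constants, which respects its arity. -/
structure OpSig where
  Op : Type
  args : Op → List Base
  res : Op → Base
  eval : Op → List Const → Option Const
  eval_ty : ∀ o cs c, cs.map Const.ty = args o → eval o cs = some c → c.ty = res o

/-- Abstract function names, annotated with the function type they represent. There are infinitely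
many names of each function type. -/
structure Name : Type where
  id : ℕ
  dom : Ty
  cod : Ty

/-- An occurrence of a location: a free (i.e. global) location, or a de Bruijn index
referring to an enclosing location binder. -/
inductive LRef : Type
  | free (l : ℕ)
  | bound (k : ℕ)

/-! ### Expressions -/

/-- Expressions, up to renaming of bound variables and bound locations (de Bruijn indices).
* `lam T T' e` is the recursive function `λ^f x. e` of type `T → T'`;
  in `e`, index `0` is the argument `x` and index `1` is the function `f` itself.
* `new v e` is `new l v e`; it binds a location in `e`.
* `letIn n e e'` is `let (x₁,…,xₙ) = e in e'`; in `e'`, the indices `0,…,n-1` are `x₁,…,xₙ`. -/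
inductive Exp (O : OpSig) : Type
  | const (c : Const)
  | var (n : ℕ)
  | lam (T T' : Ty) (e : Exp O)
  | name (a : Name)
  | tuple (es : List (Exp O))
  | op (o : O.Op) (es : List (Exp O))
  | app (e e' : Exp O)
  | ite (e e₁ e₂ : Exp O)
  | new (v e : Exp O)
  | deref (l : LRef)
  | assign (l : LRef) (e : Exp O)
  | letIn (n : ℕ) (e e' : Exp O)

variable {O : OpSig}

/-- Values: constants, variables, functions, abstract names, and tuples of values. -/
inductive IsVal : Exp O → Prop
  | const (c : Const) : IsVal (.const c)
  | var (n : ℕ) : IsVal (.var n)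
  | lam (T T' : Ty) (e : Exp O) : IsVal (.lam T T' e)
  | name (a : Name) : IsVal (.name a)
  | tuple (es : List (Exp O)) (h : ∀ e ∈ es, IsVal e) : IsVal (.tuple es)

/-- `v` is a function value of (annotated) type `T → T'`. -/
inductive IsFun : Exp O → Ty → Ty → Prop
  | lam (T T' : Ty) (e : Exp O) : IsFun (.lam T T' e) T T'
  | name (a : Name) : IsFun (.name a) a.dom a.cod

mutual
/-- `e.inst k vs` substitutes the values `vs` for the variables `k, k+1, …, k + vs.length - 1`.
Reduction only ever substitutes closed values, so that these need no shifting under binders. -/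
def Exp.inst (k : ℕ) (vs : List (Exp O)) : Exp O → Exp O
  | .const c => .const c
  | .var n => if n < k then .var n else (vs[n - k]?).getD (.var (n - vs.length))
  | .lam T T' e => .lam T T' (e.inst (k + 2) vs)
  | .name a => .name a
  | .tuple es => .tuple (Exp.insts k vs es)
  | .op o es => .op o (Exp.insts k vs es)
  | .app e e' => .app (e.inst k vs) (e'.inst k vs)
  | .ite e e₁ e₂ => .ite (e.inst k vs) (e₁.inst k vs) (e₂.inst k vs)
  | .new v e => .new (v.inst k vs) (e.inst k vs)
  | .deref l => .deref l
  | .assign l e => .assign l (e.inst k vs)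
  | .letIn n e e' => .letIn n (e.inst k vs) (e'.inst (k + n) vs)
/-- `Exp.inst` on lists of expressions. -/
def Exp.insts (k : ℕ) (vs : List (Exp O)) : List (Exp O) → List (Exp O)
  | [] => []
  | e :: es => e.inst k vs :: Exp.insts k vs es
end

/-- Replace the bound location `k` by the free location `l`. -/
def LRef.openAt (k l : ℕ) : LRef → LRef
  | .free l' => .free l'
  | .bound j => if j = k then .free l else .bound j

mutual
/-- Replace the bound location `k` by the free location `l` in an expression. -/
def Exp.openLoc (k l : ℕ) : Exp O → Exp O
  | .const c => .const c
  | .var n => .var n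
  | .lam T T' e => .lam T T' (e.openLoc k l)
  | .name a => .name a
  | .tuple es => .tuple (Exp.openLocs k l es)
  | .op o es => .op o (Exp.openLocs k l es)
  | .app e e' => .app (e.openLoc k l) (e'.openLoc k l)
  | .ite e e₁ e₂ => .ite (e.openLoc k l) (e₁.openLoc k l) (e₂.openLoc k l)
  | .new v e => .new (v.openLoc k l) (e.openLoc (k + 1) l)
  | .deref r => .deref (r.openAt k l)
  | .assign r e => .assign (r.openAt k l) (e.openLoc k l)
  | .letIn n e e' => .letIn n (e.openLoc k l) (e'.openLoc k l)
/-- `Exp.openLoc` on lists of expressions. -/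
def Exp.openLocs (k l : ℕ) : List (Exp O) → List (Exp O)
  | [] => []
  | e :: es => e.openLoc k l :: Exp.openLocs k l es
end

mutual
/-- The set of abstract names of an expression. -/
def Exp.names : Exp O → Set Name
  | .const _ => ∅
  | .var _ => ∅
  | .lam _ _ e => e.names
  | .name a => {a}
  | .tuple es => Exp.namess es
  | .op _ es => Exp.namess es
  | .app e e' => e.names ∪ e'.names
  | .ite e e₁ e₂ => e.names ∪ e₁.names ∪ e₂.names
  | .new v e => v.names ∪ e.names
  | .deref _ => ∅
  | .assign _ e => e.names
  | .letIn _ e e' => e.names ∪ e'.names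
/-- The set of abstract names of a list of expressions. -/
def Exp.namess : List (Exp O) → Set Name
  | [] => ∅
  | e :: es => e.names ∪ Exp.namess es
end

/-! ### Typing -/

/-- The type of a location occurrence, for `S` the typing of free locations and `L` the types of
the bound ones. -/
def LRef.ty (S : ℕ → Option Ty) (L : List Ty) : LRef → Option Ty
  | .free l => S l
  | .bound k => L[k]?

/-- Typing judgements `Δ; S ⊢ e : T`; the list `L` holds the types of the bound locations in
scope. -/
inductive HasTy (S : ℕ → Option Ty) : List Ty → List Ty → Exp O → Ty → Prop
  | const {Δ L} (c : Const) : HasTy S Δ L (.const c) (.base c.ty)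
  | var {Δ L} (n : ℕ) (T : Ty) (h : Δ[n]? = some T) : HasTy S Δ L (.var n) T
  | lam {Δ L} (T T' : Ty) (e : Exp O) (h : HasTy S (T :: .arr T T' :: Δ) L e T') :
      HasTy S Δ L (.lam T T' e) (.arr T T')
  | name {Δ L} (a : Name) : HasTy S Δ L (.name a) (.arr a.dom a.cod)
  | tuple {Δ L} (es : List (Exp O)) (Ts : List Ty) (hlen : es.length = Ts.length)
      (h : ∀ p ∈ es.zip Ts, HasTy S Δ L p.1 p.2) : HasTy S Δ L (.tuple es) (.prod Ts)
  | op {Δ L} (o : O.Op) (es : List (Exp O)) (hlen : es.length = (O.args o).length)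
      (h : ∀ p ∈ es.zip (O.args o), HasTy S Δ L p.1 (.base p.2)) :
      HasTy S Δ L (.op o es) (.base (O.res o))
  | app {Δ L} (e e' : Exp O) (T T' : Ty) (h : HasTy S Δ L e (.arr T T')) (h' : HasTy S Δ L e' T) :
      HasTy S Δ L (.app e e') T'
  | ite {Δ L} (e e₁ e₂ : Exp O) (T : Ty) (h : HasTy S Δ L e (.base .bool))
      (h₁ : HasTy S Δ L e₁ T) (h₂ : HasTy S Δ L e₂ T) : HasTy S Δ L (.ite e e₁ e₂) T
  | new {Δ L} (v e : Exp O) (T T' : Ty) (hv : IsVal v) (h : HasTy S Δ L v T)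
      (h' : HasTy S Δ (T :: L) e T') : HasTy S Δ L (.new v e) T'
  | deref {Δ L} (l : LRef) (T : Ty) (h : l.ty S L = some T) : HasTy S Δ L (.deref l) T
  | assign {Δ L} (l : LRef) (e : Exp O) (T : Ty) (h : l.ty S L = some T) (h' : HasTy S Δ L e T) :
      HasTy S Δ L (.assign l e) (.base .unit)
  | letIn {Δ L} (Ts : List Ty) (e e' : Exp O) (T : Ty) (h : HasTy S Δ L e (.prod Ts))
      (h' : HasTy S (Ts ++ Δ) L e' T) : HasTy S Δ L (.letIn Ts.length e e') T

/-! ### Evaluation contexts and reduction -/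

/-- Evaluation contexts (see `ECtx.Valid` for the requirement that the components on the left of
the hole are values). -/
inductive ECtx (O : OpSig) : Type
  | hole
  | tuple (vs : List (Exp O)) (E : ECtx O) (es : List (Exp O))
  | op (o : O.Op) (vs : List (Exp O)) (E : ECtx O) (es : List (Exp O))
  | appL (E : ECtx O) (e : Exp O)
  | appR (v : Exp O) (E : ECtx O)
  | assign (l : LRef) (E : ECtx O)
  | ite (E : ECtx O) (e₁ e₂ : Exp O)
  | letIn (n : ℕ) (E : ECtx O) (e : Exp O)

/-- `E.fill e` is `E[e]`. -/
def ECtx.fill : ECtx O → Exp O → Exp O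
  | .hole, e => e
  | .tuple vs E es, e => .tuple (vs ++ E.fill e :: es)
  | .op o vs E es, e => .op o (vs ++ E.fill e :: es)
  | .appL E e', e => .app (E.fill e) e'
  | .appR v E, e => .app v (E.fill e)
  | .assign l E, e => .assign l (E.fill e)
  | .ite E e₁ e₂, e => .ite (E.fill e) e₁ e₂
  | .letIn n E e', e => .letIn n (E.fill e) e'

/-- The components to the left of the hole are values. -/
def ECtx.Valid : ECtx O → Prop
  | .hole => True
  | .tuple vs E _ => (∀ v ∈ vs, IsVal v) ∧ E.Valid
  | .op _ vs E _ => (∀ v ∈ vs, IsVal v) ∧ E.Valid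
  | .appL E _ => E.Valid
  | .appR v E => IsVal v ∧ E.Valid
  | .assign _ E => E.Valid
  | .ite E _ _ => E.Valid
  | .letIn _ E _ => E.Valid

/-- The abstract names of an evaluation context. -/
def ECtx.names (E : ECtx O) : Set Name := (E.fill (.const .unit)).names

/-- Stores: finite partial maps from locations to values. -/
abbrev Store (O : OpSig) := Finmap (fun _ : ℕ => Exp O)

/-- Knowledge environments: finite partial maps from indices to values. -/
abbrev Env (O : OpSig) := Finmap (fun _ : ℕ => Exp O)

/-- Base reduction. -/
inductive RedBase : Store O → Exp O → Store O → Exp O → Prop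
  | op (s : Store O) (o : O.Op) (cs : List Const) (w : Const) (h : O.eval o cs = some w) :
      RedBase s (.op o (cs.map Exp.const)) s (.const w)
  | beta (s : Store O) (T T' : Ty) (e v : Exp O) (hv : IsVal v) :
      RedBase s (.app (.lam T T' e) v) s (e.inst 0 [v, .lam T T' e])
  | letIn (s : Store O) (vs : List (Exp O)) (e : Exp O) (hv : ∀ v ∈ vs, IsVal v) :
      RedBase s (.letIn vs.length (.tuple vs) e) s (e.inst 0 vs)
  | new (s : Store O) (l : ℕ) (v e : Exp O) (hv : IsVal v) (hl : l ∉ s) :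
      RedBase s (.new v e) (s.insert l v) (e.openLoc 0 l)
  | deref (s : Store O) (l : ℕ) (v : Exp O) (h : s.lookup l = some v) :
      RedBase s (.deref (.free l)) s v
  | assign (s : Store O) (l : ℕ) (v : Exp O) (hv : IsVal v) :
      RedBase s (.assign (.free l) v) (s.insert l v) (.const .unit)
  | iteTrue (s : Store O) (e₁ e₂ : Exp O) : RedBase s (.ite (.const (.bool true)) e₁ e₂) s e₁
  | iteFalse (s : Store O) (e₁ e₂ : Exp O) : RedBase s (.ite (.const (.bool false)) e₁ e₂) s e₂

/-- Small-step reduction, in an evaluation context. -/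
inductive Red : Store O → Exp O → Store O → Exp O → Prop
  | ctx (E : ECtx O) (hE : E.Valid) (s s' : Store O) (e e' : Exp O) (h : RedBase s e s' e') :
      Red s (E.fill e) s' (E.fill e')

/-! ### Ultimate patterns -/

/-- Function-free contexts built from constants, tuples and indexed holes `[·]_{i, T → T'}` that
stand for functions. -/
inductive Pat : Type
  | const (c : Const)
  | tuple (Ds : List Pat)
  | hole (i : ℕ) (T T' : Ty)

mutual
/-- The holes of a pattern, from left to right. -/
def Pat.holes : Pat → List (ℕ × Ty × Ty)
  | .const _ => []
  | .tuple Ds => Pat.holess Ds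
  | .hole i T T' => [(i, T, T')]
/-- The holes of a list of patterns. -/
def Pat.holess : List Pat → List (ℕ × Ty × Ty)
  | [] => []
  | D :: Ds => D.holes ++ Pat.holess Ds
end

mutual
/-- `D.fill Γ` is `D[Γ]`; it is only used when the holes of `D` have their indices in the domain
of `Γ`. -/
def Pat.fill (Γ : Env O) : Pat → Exp O
  | .const c => .const c
  | .tuple Ds => .tuple (Pat.fills Γ Ds)
  | .hole i _ _ => (Γ.lookup i).getD (.const .unit)
/-- `Pat.fill` on lists of patterns. -/
def Pat.fills (Γ : Env O) : List Pat → List (Exp O)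
  | [] => []
  | D :: Ds => D.fill Γ :: Pat.fills Γ Ds
end

/-- `(D, Γ)` is an ultimate pattern of the value `v`: the holes of `D` have distinct indices, these
are the domain of `Γ`, each is mapped to a function of the type of the hole, and `D[Γ] = v`. -/
structure UltPat (v : Exp O) (D : Pat) (Γ : Env O) : Prop where
  nodup : (D.holes.map Prod.fst).Nodup
  dom : ∀ i, i ∈ Γ ↔ i ∈ D.holes.map Prod.fst
  isFun : ∀ i T T', (i, T, T') ∈ D.holes → ∃ w, Γ.lookup i = some w ∧ IsFun w T T'
  fill : D.fill Γ = v

/-- Ultimate patterns of a type: `u = D[α⃗]` has type `T`, where `D` contains no functions and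
`α⃗` is a sequence of distinct abstract names, one for each hole of `D`. -/
def OppVal (T : Ty) (u : Exp O) : Prop :=
  ∃ (D : Pat) (as : Env O), UltPat u D as ∧
    (∀ i w, as.lookup i = some w → ∃ a, w = .name a) ∧
    (∀ i j w, as.lookup i = some w → as.lookup j = some w → i = j) ∧
    HasTy (fun _ => none) [] [] u T

/-! ### Configurations and their transitions -/

/-- A proponent continuation `E[·]_T`, with the type of its hole. -/
structure Frame (O : OpSig) where
  holeTy : Ty
  ctx : ECtx O

/-- Configurations `⟨A; Γ; K; s; ê⟩`, where `ê = none` in opponent configurations, and the special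
configuration `⊥`. -/
inductive Conf (O : OpSig) : Type
  | bot
  | mk (A : Set Name) (Γ : Env O) (K : List (Frame O)) (s : Store O) (e : Option (Exp O))

/-- `S` is the typing of the store `s`. -/
structure StoreTyping (s : Store O) (S : ℕ → Option Ty) : Prop where
  dom : ∀ l, (∃ T, S l = some T) ↔ l ∈ s
  typed : ∀ l v T, s.lookup l = some v → S l = some T → IsVal v ∧ HasTy S [] [] v T

/-- Well-formed configurations: the set `A` is finite and contains all abstract names of the
configuration, and all components are closed and well typed with respect to the typing of the
store (hence all their locations are in the domain of the store). -/
def WellFormed (A : Set Name) (Γ : Env O) (K : List (Frame O)) (s : Store O)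
    (e : Option (Exp O)) : Prop :=
  A.Finite ∧
  (∀ i v, Γ.lookup i = some v → v.names ⊆ A) ∧
  (∀ F ∈ K, F.ctx.names ⊆ A) ∧
  (∀ l v, s.lookup l = some v → v.names ⊆ A) ∧
  (∀ e₀, e = some e₀ → e₀.names ⊆ A) ∧
  ∃ S : ℕ → Option Ty, StoreTyping s S ∧
    (∀ i v, Γ.lookup i = some v → IsVal v ∧ ∃ T, HasTy S [] [] v T) ∧
    (∀ F ∈ K, F.ctx.Valid ∧ ∃ T', ∀ e₀, HasTy S [] [] e₀ F.holeTy →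
      HasTy S [] [] (F.ctx.fill e₀) T') ∧
    (∀ e₀, e = some e₀ → ∃ T, HasTy S [] [] e₀ T)

/-- Transition labels: proponent application and return, opponent application and return, internal
step, and termination. -/
inductive Label (O : OpSig) : Type
  | papp (a : Name) (D : Pat)
  | pret (D : Pat)
  | oapp (i : ℕ) (u : Exp O)
  | oret (u : Exp O)
  | tau
  | term

/-- The first step of the application of a function value `v` to `u` by the opponent. -/
inductive FunRed : Exp O → Exp O → Exp O → Prop
  | name (a : Name) (u : Exp O) : FunRed (.name a) u (.app (.name a) u)
  | lam (T T' : Ty) (e u : Exp O) : FunRed (.lam T T' e) u (e.inst 0 [u, .lam T T' e])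

/-- The labelled transition system. -/
inductive Trans : Conf O → Label O → Conf O → Prop
  | propApp (A : Set Name) (Γ Γ' : Env O) (K : List (Frame O)) (s : Store O) (E : ECtx O)
      (a : Name) (v : Exp O) (D : Pat) (hE : E.Valid) (hv : IsVal v) (hD : UltPat v D Γ')
      (hΓ : Γ.Disjoint Γ') :
      Trans (.mk A Γ K s (some (E.fill (.app (.name a) v)))) (.papp a D)
        (.mk A (Γ ∪ Γ') (⟨a.cod, E⟩ :: K) s none)
  | propRet (A : Set Name) (Γ Γ' : Env O) (K : List (Frame O)) (s : Store O)
      (v : Exp O) (D : Pat) (hv : IsVal v) (hD : UltPat v D Γ') (hΓ : Γ.Disjoint Γ') :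
      Trans (.mk A Γ K s (some v)) (.pret D) (.mk A (Γ ∪ Γ') K s none)
  | opApp (A : Set Name) (Γ : Env O) (K : List (Frame O)) (s : Store O) (S : ℕ → Option Ty)
      (i : ℕ) (v u e : Exp O) (T T' : Ty) (hi : Γ.lookup i = some v) (hS : StoreTyping s S)
      (hT : HasTy S [] [] v (.arr T T')) (hu : OppVal T u) (hA : Disjoint A u.names)
      (he : FunRed v u e) :
      Trans (.mk A Γ K s none) (.oapp i u) (.mk (A ∪ u.names) Γ K s (some e))
  | opRet (A : Set Name) (Γ : Env O) (K : List (Frame O)) (s : Store O) (T : Ty) (E : ECtx O)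
      (u : Exp O) (hu : OppVal T u) (hA : Disjoint A u.names) :
      Trans (.mk A Γ (⟨T, E⟩ :: K) s none) (.oret u) (.mk (A ∪ u.names) Γ K s (some (E.fill u)))
  | tau (A : Set Name) (Γ : Env O) (K : List (Frame O)) (s s' : Store O) (e e' : Exp O)
      (h : Red s e s' e') :
      Trans (.mk A Γ K s (some e)) .tau (.mk A Γ K s' (some e'))
  | response (C : Conf O) (η : Label O) (h : η ≠ .term) : Trans C η .bot
  | term (A : Set Name) (Γ : Env O) (s : Store O) : Trans (.mk A Γ [] s none) .term .bot

/-- `τ`-transitions, any number of them. -/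
def TauStar : Conf O → Conf O → Prop :=
  Relation.ReflTransGen (fun C C' => Trans C .tau C')

/-- Weak transitions. -/
def WTrans (C : Conf O) (η : Label O) (C' : Conf O) : Prop :=
  (η = .tau ∧ TauStar C C') ∨
  (η ≠ .tau ∧ ∃ C₁ C₂, TauStar C C₁ ∧ Trans C₁ η C₂ ∧ TauStar C₂ C')

/-! ### Simulations and up-to techniques -/

/-- Binary relations on configurations (a complete lattice, ordered by inclusion). -/
abbrev CRel (O : OpSig) := Conf O → Conf O → Prop

/-- Weak progression: the relation `WP R`. -/
def WP (R : CRel O) : CRel O := fun C₁ C₂ =>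
  ∀ η C₁', Trans C₁ η C₁' → ∃ C₂', WTrans C₂ η C₂' ∧ R C₁' C₂'

/-- `R` is a weak simulation. -/
def IsWeakSim (R : CRel O) : Prop := R ≤ WP R

/-- Similarity: the largest weak simulation. -/
def Similarity : CRel O := fun C₁ C₂ => ∃ R : CRel O, IsWeakSim R ∧ R C₁ C₂

/-- `R` is a weak simulation up to `f`. -/
def IsWeakSimUpTo (f : CRel O → CRel O) (R : CRel O) : Prop := R ≤ WP (f R)

/-- Sound up-to techniques. -/
def IsSoundUpTo (f : CRel O → CRel O) : Prop :=
  ∀ R : CRel O, IsWeakSimUpTo f R → R ≤ Similarity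

/-- Compatible functions: monotone `f` with `f ∘ WP ⊑ WP ∘ f`. -/
def IsCompatible (f : CRel O → CRel O) : Prop :=
  Monotone f ∧ ∀ R : CRel O, f (WP R) ≤ WP (f R)

/-- The companion: the pointwise union of all compatible functions. -/
def companion : CRel O → CRel O := fun R C₁ C₂ => ∃ f, IsCompatible f ∧ f R C₁ C₂

/-- `f^ω`, the pointwise union of the iterates `f^n`, for `n < ω`. -/
def omegaIter (f : CRel O → CRel O) : CRel O → CRel O := fun R C₁ C₂ => ∃ n : ℕ, (f^[n]) R C₁ C₂

/-! ### Separating conjunction and up to separation -/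

/-- The two components of a separating conjunction. -/
inductive Side : Type
  | one
  | two

/-- `Interleave k K₁ K₂ K` states that `K` is the interleaving of `K₁` and `K₂` along `k`. -/
inductive Interleave : List Side → List (Frame O) → List (Frame O) → List (Frame O) → Prop
  | nil : Interleave [] [] [] []
  | one (k : List Side) (E : Frame O) (K₁ K₂ K : List (Frame O)) (h : Interleave k K₁ K₂ K) :
      Interleave (.one :: k) (E :: K₁) K₂ (E :: K)
  | two (k : List Side) (E : Frame O) (K₁ K₂ K : List (Frame O)) (h : Interleave k K₁ K₂ K) :
      Interleave (.two :: k) K₁ (E :: K₂) (E :: K)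

/-- `SepConj i k C₁ C₂ C` states that the separating conjunction of `C₁` and `C₂`, along `k` and
with the expression of component `i`, is defined and equal to `C`. -/
inductive SepConj : Side → List Side → Conf O → Conf O → Conf O → Prop
  | one (k : List Side) (A₁ A₂ : Set Name) (Γ₁ Γ₂ : Env O) (K₁ K₂ K : List (Frame O))
      (s₁ s₂ : Store O) (e : Option (Exp O))
      (h₁ : WellFormed A₁ Γ₁ K₁ s₁ e) (h₂ : WellFormed A₂ Γ₂ K₂ s₂ none)
      (hΓ : Γ₁.Disjoint Γ₂) (hK : Interleave k K₁ K₂ K) (hs : s₁.Disjoint s₂) :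
      SepConj .one k (.mk A₁ Γ₁ K₁ s₁ e) (.mk A₂ Γ₂ K₂ s₂ none)
        (.mk (A₁ ∪ A₂) (Γ₁ ∪ Γ₂) K (s₁ ∪ s₂) e)
  | two (k : List Side) (A₁ A₂ : Set Name) (Γ₁ Γ₂ : Env O) (K₁ K₂ K : List (Frame O))
      (s₁ s₂ : Store O) (e : Option (Exp O))
      (h₁ : WellFormed A₁ Γ₁ K₁ s₁ none) (h₂ : WellFormed A₂ Γ₂ K₂ s₂ e)
      (hΓ : Γ₁.Disjoint Γ₂) (hK : Interleave k K₁ K₂ K) (hs : s₁.Disjoint s₂) :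
      SepConj .two k (.mk A₁ Γ₁ K₁ s₁ none) (.mk A₂ Γ₂ K₂ s₂ e)
        (.mk (A₁ ∪ A₂) (Γ₁ ∪ Γ₂) K (s₁ ∪ s₂) e)

/-- The abstract names recorded in a configuration. -/
def Conf.used : Conf O → Set Name
  | .bot => ∅
  | .mk A _ _ _ _ => A

/-- The domain of the environment of a configuration. -/
def Conf.envDom : Conf O → Finset ℕ
  | .bot => ∅
  | .mk _ Γ _ _ _ => Γ.keys

/-- The up-to-separation function. -/
inductive utSep (R : CRel O) : CRel O
  | sep (i : Side) (k : List Side) (C₁ C₂ C₃ C₄ C C' : Conf O) (h₁ : R C₁ C₂) (h₂ : R C₃ C₄)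
      (hd₁ : C₁.envDom = C₂.envDom) (hd₂ : C₃.envDom = C₄.envDom)
      (hA₁ : C₂.used ⊆ C₁.used) (hA₂ : C₄.used ⊆ C₃.used)
      (hC : SepConj i k C₁ C₃ C) (hC' : SepConj i k C₂ C₄ C') : utSep R C C'
  | botL (i : Side) (k : List Side) (C₁ C₃ C₄ C : Conf O) (h₁ : R C₁ .bot) (h₂ : R C₃ C₄)
      (hC : SepConj i k C₁ C₃ C) : utSep R C .bot
  | botR (i : Side) (k : List Side) (C₁ C₂ C₃ C : Conf O) (h₁ : R C₁ C₂) (h₂ : R C₃ .bot)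
      (hC : SepConj i k C₁ C₃ C) : utSep R C .bot

end SepUpTo

/-!
The least class of relations closed under `WP` and under intersections is the class of values of
the companion, so `sep ⊑ t` amounts to every relation of this class being closed under `sep`. By
induction on the class, it is enough that `WP x` is closed under `sep` when `x` is in the class and
closed under `sep`. Relations in the class are moreover reflexive and closed under renaming the
locations of the right-hand configuration, and they contain their image under `WP`.

A transition of a conjunction other than a response or a termination is a transition of one of its
components, because in a component that is well typed on its own a reduction only touches its own
part of the store. The component is answered by a weak transition of its partner, which is again a
transition of the other conjunction once the locations it allocates are renamed away from the store
of the remaining component. What could go wrong is that an opponent configuration is related to a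
proponent one, which would block the moves of the other component; but then it is related to `⊥` as
well, since a proponent configuration only reaches `⊥` by an opponent label.
-/

namespace SepUpTo

variable {O : OpSig}

/-! ### The companion as a tower of relations -/

section Tower

variable {α : Type*} [CompleteLattice α] {b f : α → α} {x : α}

/-- The tower of `b`: the least class of elements closed under `b` and under infima. For monotone
`b` it is the image of the companion of `b`, so that membership in it can be proved by tower
induction. -/
inductive Tower (b : α → α) : α → Prop
  | step (x : α) (h : Tower b x) : Tower b (b x)
  | sInf (X : Set α) (h : ∀ x ∈ X, Tower b x) : Tower b (sInf X)

theorem Tower.le_of_compatible (hx : Tower b x) (hb : Monotone b) (hf : Monotone f)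
    (hfb : ∀ y, f (b y) ≤ b (f y)) : f x ≤ x := by
  induction hx with
  | step x _ ih => exact (hfb x).trans (hb ih)
  | sInf X _ ih => exact le_sInf fun x hx => (hf (sInf_le hx)).trans (ih x hx)

theorem Tower.map_le (hx : Tower b x) (hb : Monotone b) : b x ≤ x :=
  hx.le_of_compatible hb hb fun _ => le_rfl

/-- The closure operator sending an element to the least element of the tower of `b` above it. -/
def towerClosure (b : α → α) : ClosureOperator α :=
  .ofCompletePred (Tower b) .sInf

theorem tower_towerClosure (b : α → α) (x : α) : Tower b (towerClosure b x) :=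
  (towerClosure b).isClosed_closure x

theorem towerClosure_map_le (hb : Monotone b) (x : α) :
    towerClosure b (b x) ≤ b (towerClosure b x) :=
  ClosureOperator.closure_min (hb ((towerClosure b).le_closure x))
    (Tower.step _ (tower_towerClosure b x))

theorem iterate_le_closure (c : ClosureOperator α) (hf : f ≤ c) (n : ℕ) : f^[n] ≤ c := by
  intro x
  induction n with
  | zero => exact c.le_closure x
  | succ n ih =>
    calc f^[n + 1] x = f (f^[n] x) := Function.iterate_succ_apply' f n x
      _ ≤ c (f^[n] x) := hf _
      _ ≤ c x := ClosureOperator.closure_min ih (c.isClosed_closure x)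

end Tower

theorem WP_mono : Monotone (WP (O := O)) := by
  intro R R' hR C₁ C₂ h η C₁' ht
  obtain ⟨C₂', hw, h'⟩ := h η C₁' ht
  exact ⟨C₂', hw, hR _ _ h'⟩

theorem companion_eq_towerClosure : companion (O := O) = towerClosure WP := by
  funext R
  apply le_antisymm
  · rintro C₁ C₂ ⟨f, hf, h⟩
    exact (tower_towerClosure WP R).le_of_compatible WP_mono hf.1 hf.2 _ _
      (hf.1 ((towerClosure WP).le_closure R) _ _ h)
  · exact fun _ _ h => ⟨_, ⟨(towerClosure WP).monotone, towerClosure_map_le WP_mono⟩, h⟩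

theorem id_le_companion : id ≤ companion (O := O) :=
  companion_eq_towerClosure ▸ (towerClosure WP).le_closure

theorem le_companion_of_tower {f : CRel O → CRel O} (hf : Monotone f)
    (h : ∀ R, Tower WP R → f R ≤ R) : f ≤ companion := by
  rw [companion_eq_towerClosure]
  exact fun R => (hf ((towerClosure WP).le_closure R)).trans (h _ (tower_towerClosure WP R))

theorem omegaIter_le_companion {f : CRel O → CRel O} (hf : f ≤ companion) :
    omegaIter f ≤ companion := by
  rw [companion_eq_towerClosure] at hf ⊢
  rintro R C₁ C₂ ⟨n, h⟩
  exact iterate_le_closure _ hf n R _ _ h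

theorem isSoundUpTo_companion : IsSoundUpTo (companion (O := O)) := by
  rw [companion_eq_towerClosure]
  intro R hR C₁ C₂ h
  refine ⟨towerClosure WP R, ?_, (towerClosure WP).le_closure R _ _ h⟩
  calc towerClosure WP R ≤ towerClosure WP (WP (towerClosure WP R)) :=
        (towerClosure WP).monotone hR
    _ ≤ WP (towerClosure WP (towerClosure WP R)) := towerClosure_map_le WP_mono _
    _ = WP (towerClosure WP R) := by rw [ClosureOperator.idempotent]

theorem IsSoundUpTo.anti {f g : CRel O → CRel O} (hg : IsSoundUpTo g) (h : f ≤ g) :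
    IsSoundUpTo f :=
  fun R hR => hg R (hR.trans (WP_mono (h R)))

/-! ### Finite maps -/

section FiniteMaps

variable {α α' β β' : Type*} {m m₁ m₂ m₃ : Finmap fun _ : α => β}

theorem disjoint_iff_disjoint_keys : m₁.Disjoint m₂ ↔ Disjoint m₁.keys m₂.keys := by
  simp [Finset.disjoint_left, Finmap.Disjoint, Finmap.mem_keys]

/-- Apply `g` to the keys and `f` to the values of a finite map. -/
def mapFinmap (g : α ↪ α') (f : β → β') (m : Finmap fun _ : α => β) : Finmap fun _ : α' => β' :=
  ⟨m.entries.map fun p => ⟨g p.1, f p.2⟩, by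
    rw [← Multiset.nodup_keys]
    have := (Multiset.nodup_keys.2 m.nodupKeys).map g.injective
    simpa [Multiset.keys, Multiset.map_map, Function.comp_def] using this⟩

theorem mem_mapFinmap {g : α ↪ α'} {f : β → β'} {a' : α'} :
    a' ∈ mapFinmap g f m ↔ ∃ a ∈ m, g a = a' := by
  simp [mapFinmap, Finmap.mem_def, Multiset.keys]

theorem apply_mem_mapFinmap {g : α ↪ α'} {f : β → β'} {a : α} : g a ∈ mapFinmap g f m ↔ a ∈ m := by
  simp [mem_mapFinmap]

theorem disjoint_mapFinmap (g : α ↪ α') (f : β → β') (h : m₁.Disjoint m₂) :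
    (mapFinmap g f m₁).Disjoint (mapFinmap g f m₂) := by
  intro a' h₁' h₂'
  obtain ⟨a, ha, rfl⟩ := mem_mapFinmap.1 h₁'
  exact h a ha (apply_mem_mapFinmap.1 h₂')

variable [DecidableEq α] [DecidableEq α']

theorem lookup_insert_eq_some {a a' : α} {b b' : β} :
    (m.insert a b).lookup a' = some b' ↔ a' = a ∧ b = b' ∨ a' ≠ a ∧ m.lookup a' = some b' := by
  by_cases h : a' = a
  · subst h
    simp
  · simp [Finmap.lookup_insert_of_ne _ h, h]

theorem disjoint_insert_left {a : α} (h : m₁.Disjoint m₂) (ha : a ∉ m₂) (b : β) :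
    (m₁.insert a b).Disjoint m₂ := by
  intro a' h'
  rcases Finmap.mem_insert.1 h' with rfl | h'
  exacts [ha, h a' h']

theorem union_right_comm_of_disjoint (h : m₂.Disjoint m₃) : m₁ ∪ m₂ ∪ m₃ = m₁ ∪ m₃ ∪ m₂ := by
  rw [Finmap.union_assoc, Finmap.union_comm_of_disjoint h, Finmap.union_assoc]

/-- All values of the finite map `m` satisfy `P`. -/
def AllValues (P : β → Prop) (m : Finmap fun _ : α => β) : Prop :=
  ∀ a b, m.lookup a = some b → P b

section AllValues

variable {P Q : β → Prop}

theorem AllValues.imp (hm : AllValues P m) (h : ∀ b, P b → Q b) : AllValues Q m :=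
  fun a b hb => h b (hm a b hb)

theorem AllValues.insert (hm : AllValues P m) {b : β} (hb : P b) (a : α) :
    AllValues P (m.insert a b) := by
  intro a' b' h
  rcases lookup_insert_eq_some.1 h with ⟨-, rfl⟩ | ⟨-, h⟩
  exacts [hb, hm _ _ h]

theorem AllValues.union (h₁ : AllValues P m₁) (h₂ : AllValues P m₂) : AllValues P (m₁ ∪ m₂) := by
  intro a b h
  rcases Finmap.mem_lookup_union.1 h with h | ⟨-, h⟩
  exacts [h₁ a b h, h₂ a b h]

end AllValues

section mapFinmap

variable {g : α ↪ α'} {f : β → β'}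

theorem lookup_mapFinmap_eq_some {a' : α'} {b' : β'} :
    (mapFinmap g f m).lookup a' = some b' ↔ ∃ a b, m.lookup a = some b ∧ g a = a' ∧ f b = b' := by
  simp only [Finmap.lookup_eq_some_iff, mapFinmap, Multiset.mem_map, Sigma.mk.injEq, heq_eq_eq,
    Sigma.exists]

theorem lookup_mapFinmap (g : α ↪ α') (f : β → β') (m : Finmap fun _ : α => β) (a : α) :
    (mapFinmap g f m).lookup (g a) = (m.lookup a).map f := by
  ext b
  simp [lookup_mapFinmap_eq_some, g.injective.eq_iff]

theorem mapFinmap_insert (g : α ↪ α') (f : β → β') (m : Finmap fun _ : α => β) (a : α) (b : β) :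
    mapFinmap g f (m.insert a b) = (mapFinmap g f m).insert (g a) (f b) := by
  refine Finmap.ext_lookup fun a' => Option.ext fun b' => ?_
  by_cases h : a' ∈ Set.range g
  · obtain ⟨a', rfl⟩ := h
    rw [lookup_mapFinmap, lookup_insert_eq_some, Option.map_eq_some_iff, g.injective.eq_iff,
      g.injective.ne_iff, lookup_mapFinmap, Option.map_eq_some_iff]
    simp only [lookup_insert_eq_some]
    grind
  · rw [lookup_insert_eq_some, lookup_mapFinmap_eq_some, lookup_mapFinmap_eq_some]
    grind

theorem mapFinmap_union (g : α ↪ α') (f : β → β') (m₁ m₂ : Finmap fun _ : α => β) :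
    mapFinmap g f (m₁ ∪ m₂) = mapFinmap g f m₁ ∪ mapFinmap g f m₂ := by
  refine Finmap.ext_lookup fun a' => ?_
  by_cases h : a' ∈ mapFinmap g f m₁
  · obtain ⟨a, ha, rfl⟩ := mem_mapFinmap.1 h
    rw [Finmap.lookup_union_left h, lookup_mapFinmap, lookup_mapFinmap,
      Finmap.lookup_union_left ha]
  · rw [Finmap.lookup_union_right h]
    refine Option.ext fun b' => ?_
    simp only [lookup_mapFinmap_eq_some]
    refine exists_congr fun a => exists_congr fun b => and_congr_left ?_
    rintro ⟨rfl, -⟩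
    rw [Finmap.lookup_union_right fun ha => h (apply_mem_mapFinmap.2 ha)]

theorem mapFinmap_eq_self {g : α ↪ α} {f : β → β}
    (h : ∀ a b, m.lookup a = some b → g a = a ∧ f b = b) : mapFinmap g f m = m := by
  refine Finmap.ext_lookup fun a => Option.ext fun b => ?_
  rw [lookup_mapFinmap_eq_some]
  grind

end mapFinmap

end FiniteMaps

/-! ### Expressions and patterns -/

@[elab_as_elim]
theorem Exp.induct {P : Exp O → Prop} (const : ∀ c, P (.const c)) (var : ∀ n, P (.var n))
    (lam : ∀ T T' e, P e → P (.lam T T' e)) (name : ∀ a, P (.name a))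
    (tuple : ∀ es, (∀ e ∈ es, P e) → P (.tuple es))
    (op : ∀ o es, (∀ e ∈ es, P e) → P (.op o es))
    (app : ∀ e e', P e → P e' → P (.app e e'))
    (ite : ∀ e e₁ e₂, P e → P e₁ → P e₂ → P (.ite e e₁ e₂))
    (new : ∀ v e, P v → P e → P (.new v e)) (deref : ∀ l, P (.deref l))
    (assign : ∀ l e, P e → P (.assign l e))
    (letIn : ∀ n e e', P e → P e' → P (.letIn n e e')) (e : Exp O) : P e :=
  Exp.rec (motive_1 := P) (motive_2 := fun es => ∀ e ∈ es, P e)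
    const var lam name tuple op app ite new deref assign letIn
    (by simp) (fun _ _ h hs => by simpa using ⟨h, hs⟩) e

@[elab_as_elim]
theorem Pat.induct {P : Pat → Prop} (const : ∀ c, P (.const c))
    (tuple : ∀ Ds, (∀ D ∈ Ds, P D) → P (.tuple Ds))
    (hole : ∀ i T T', P (.hole i T T')) (D : Pat) : P D :=
  Pat.rec (motive_1 := P) (motive_2 := fun Ds => ∀ D ∈ Ds, P D)
    const tuple hole (by simp) (fun _ _ h hs => by simpa using ⟨h, hs⟩) D

theorem Exp.insts_eq_map (k : ℕ) (vs es : List (Exp O)) :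
    Exp.insts k vs es = es.map (Exp.inst k vs) := by
  induction es with
  | nil => simp [Exp.insts]
  | cons e es ih => simp [Exp.insts, ih]

theorem Exp.openLocs_eq_map (k l : ℕ) (es : List (Exp O)) :
    Exp.openLocs k l es = es.map (Exp.openLoc k l) := by
  induction es with
  | nil => simp [Exp.openLocs]
  | cons e es ih => simp [Exp.openLocs, ih]

theorem Exp.mem_namess {a : Name} {es : List (Exp O)} :
    a ∈ Exp.namess es ↔ ∃ e ∈ es, a ∈ e.names := by
  induction es with
  | nil => simp [Exp.namess]
  | cons e es ih => simp [Exp.namess, ih]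

theorem Exp.namess_subset_iff {A : Set Name} {es : List (Exp O)} :
    Exp.namess es ⊆ A ↔ ∀ e ∈ es, e.names ⊆ A := by
  simp only [Set.subset_def, Exp.mem_namess]
  grind

theorem Pat.fills_eq_map (Γ : Env O) (Ds : List Pat) :
    Pat.fills Γ Ds = Ds.map (Pat.fill Γ) := by
  induction Ds with
  | nil => simp [Pat.fills]
  | cons D Ds ih => simp [Pat.fills, ih]

theorem Pat.mem_holess {p : ℕ × Ty × Ty} {Ds : List Pat} :
    p ∈ Pat.holess Ds ↔ ∃ D ∈ Ds, p ∈ D.holes := by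
  induction Ds with
  | nil => simp [Pat.holess]
  | cons D Ds ih => simp [Pat.holess, ih]

theorem Exp.finite_names (e : Exp O) : e.names.Finite := by
  induction e using Exp.induct with
  | tuple es ih | op o es ih =>
    simp only [Exp.names]
    refine (Set.Finite.biUnion es.finite_toSet ih).subset fun a ha => ?_
    simpa [Exp.mem_namess] using ha
  | _ => simp_all [Exp.names]

theorem Exp.names_inst_subset {A : Set Name} {vs : List (Exp O)} (hvs : ∀ v ∈ vs, v.names ⊆ A)
    (e : Exp O) (k : ℕ) (he : e.names ⊆ A) : (e.inst k vs).names ⊆ A := by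
  induction e using Exp.induct generalizing k with
  | var n =>
    simp only [Exp.inst]
    split_ifs
    · simp [Exp.names]
    · cases h : vs[n - k]? with
      | none => simp [Exp.names]
      | some v => exact hvs v (List.mem_of_getElem? h)
  | tuple es ih | op o es ih =>
    simp only [Exp.inst, Exp.insts_eq_map, Exp.names, Exp.namess_subset_iff, List.mem_map] at he ⊢
    rintro _ ⟨e, hm, rfl⟩
    exact ih e hm k (he e hm)
  | _ => simp_all [Exp.inst, Exp.names]

theorem Exp.names_openLoc (e : Exp O) (k l : ℕ) : (e.openLoc k l).names = e.names := by
  induction e using Exp.induct generalizing k with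
  | tuple es ih | op o es ih =>
    ext a
    simp only [Exp.openLoc, Exp.openLocs_eq_map, Exp.names, Exp.mem_namess, List.mem_map]
    grind
  | _ => simp_all [Exp.openLoc, Exp.names]

theorem ECtx.names_fill_subset_iff {A : Set Name} (E : ECtx O) (e : Exp O) :
    (E.fill e).names ⊆ A ↔ E.names ⊆ A ∧ e.names ⊆ A := by
  induction E with
  | hole => simp [ECtx.names, ECtx.fill, Exp.names]
  | tuple vs E es ih | op o vs E es ih =>
    simp only [ECtx.names, ECtx.fill, Exp.names, Exp.namess_subset_iff, List.mem_append,
      List.mem_cons] at ih ⊢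
    grind
  | _ =>
    simp only [ECtx.names, ECtx.fill, Exp.names, Set.union_subset_iff] at *
    tauto

theorem IsFun.isVal {v : Exp O} {T T' : Ty} (h : IsFun v T T') : IsVal v := by
  cases h <;> constructor

theorem IsVal.inst {vs : List (Exp O)} (hvs : ∀ v ∈ vs, IsVal v) {v : Exp O} (hv : IsVal v)
    (k : ℕ) : IsVal (v.inst k vs) := by
  induction hv with
  | var n =>
    simp only [Exp.inst]
    split_ifs
    · constructor
    · cases h : vs[n - k]? with
      | none => constructor
      | some v => exact hvs v (List.mem_of_getElem? h)
  | tuple es h ih =>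
    simp only [Exp.inst, Exp.insts_eq_map]
    refine .tuple _ fun e he => ?_
    obtain ⟨e, hm, rfl⟩ := List.mem_map.1 he
    exact ih e hm
  | _ => simp only [Exp.inst]; constructor

theorem IsVal.openLoc {v : Exp O} (hv : IsVal v) (k l : ℕ) : IsVal (v.openLoc k l) := by
  induction hv with
  | tuple es h ih =>
    simp only [Exp.openLoc, Exp.openLocs_eq_map]
    refine .tuple _ fun e he => ?_
    obtain ⟨e, hm, rfl⟩ := List.mem_map.1 he
    exact ih e hm
  | _ => simp only [Exp.openLoc]; constructor

/-! ### Typing -/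

/-- `S'` extends the store typing `S`. -/
def TyLe (S S' : ℕ → Option Ty) : Prop := ∀ l T, S l = some T → S' l = some T

theorem TyLe.refl (S : ℕ → Option Ty) : TyLe S S := fun _ _ h => h

section Typing

variable {S S' : ℕ → Option Ty} {Δ L : List Ty}

theorem LRef.ty_mono (h : TyLe S S') (L' : List Ty) {l : LRef} {T : Ty}
    (hl : l.ty S L = some T) : l.ty S' (L ++ L') = some T := by
  cases l with
  | free l => exact h l T hl
  | bound k => exact (List.getElem?_append_left (List.getElem?_eq_some_iff.1 hl).1).trans hl

theorem LRef.ty_openAt {l : ℕ} {U : Ty} (hl : S l = some U) {r : LRef} {T : Ty}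
    (h : r.ty S (L ++ [U]) = some T) : (r.openAt L.length l).ty S L = some T := by
  cases r with
  | free l' => exact h
  | bound k =>
    simp only [LRef.ty, LRef.openAt] at h ⊢
    have hk := (List.getElem?_eq_some_iff.1 h).1
    rw [List.length_append, List.length_singleton] at hk
    split_ifs with hkL
    · subst hkL
      simpa [hl] using h
    · exact (List.getElem?_append_left (by omega)).symm.trans h

theorem hasTy_const_iff {c : Const} {T : Ty} :
    HasTy (O := O) S Δ L (.const c) T ↔ T = .base c.ty := by
  constructor
  · rintro ⟨⟩
    rfl
  · rintro rfl
    exact .const c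

theorem hasTy_tuple_iff {es : List (Exp O)} {T : Ty} :
    HasTy S Δ L (.tuple es) T ↔ ∃ Ts, T = .prod Ts ∧ List.Forall₂ (HasTy S Δ L) es Ts := by
  simp only [List.forall₂_iff_zip]
  constructor
  · rintro ⟨⟩
    rename_i Ts hlen h
    exact ⟨Ts, rfl, hlen, fun {a b} hab => h (a, b) hab⟩
  · rintro ⟨Ts, rfl, hlen, h⟩
    exact .tuple _ _ hlen fun p hp => h hp

theorem hasTy_op_iff {o : O.Op} {es : List (Exp O)} {T : Ty} :
    HasTy S Δ L (.op o es) T ↔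
      T = .base (O.res o) ∧ List.Forall₂ (HasTy S Δ L) es ((O.args o).map .base) := by
  rw [List.forall₂_map_right_iff, List.forall₂_iff_zip]
  constructor
  · rintro ⟨⟩
    rename_i hlen h
    exact ⟨rfl, hlen, fun {a b} hab => h (a, b) hab⟩
  · rintro ⟨rfl, hlen, h⟩
    exact .op _ _ hlen fun p hp => h hp

theorem forall₂_hasTy_const {cs : List Const} {bs : List Base}
    (h : List.Forall₂ (HasTy (O := O) S Δ L) (cs.map .const) (bs.map .base)) :
    cs.map Const.ty = bs := by
  simp only [List.forall₂_map_left_iff, List.forall₂_map_right_iff, hasTy_const_iff,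
    Ty.base.injEq] at h
  rw [← List.forall₂_eq_eq_eq, List.forall₂_map_left_iff]
  exact h.imp fun _ _ => Eq.symm

theorem HasTy.tuple_map {f : Exp O → Exp O} {es : List (Exp O)} {Ts : List Ty}
    (hlen : es.length = Ts.length) (h : ∀ p ∈ es.zip Ts, HasTy S Δ L (f p.1) p.2) :
    HasTy S Δ L (.tuple (es.map f)) (.prod Ts) :=
  hasTy_tuple_iff.2 ⟨_, rfl, List.forall₂_map_left_iff.2 <|
    List.forall₂_iff_zip.2 ⟨hlen, fun {a b} hab => h (a, b) hab⟩⟩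

theorem HasTy.op_map {f : Exp O → Exp O} {o : O.Op} {es : List (Exp O)}
    (hlen : es.length = (O.args o).length)
    (h : ∀ p ∈ es.zip (O.args o), HasTy S Δ L (f p.1) (.base p.2)) :
    HasTy S Δ L (.op o (es.map f)) (.base (O.res o)) :=
  hasTy_op_iff.2 ⟨rfl, List.forall₂_map_left_iff.2 <| List.forall₂_map_right_iff.2 <|
    List.forall₂_iff_zip.2 ⟨hlen, fun {a b} hab => h (a, b) hab⟩⟩

theorem HasTy.weaken (hS : TyLe S S') {e : Exp O} {T : Ty} (h : HasTy S Δ L e T)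
    (Δ' L' : List Ty) : HasTy S' (Δ ++ Δ') (L ++ L') e T := by
  induction h with
  | const c => exact .const c
  | var n T h => exact .var n T (List.getElem?_append_left (List.getElem?_eq_some_iff.1 h).1 ▸ h)
  | lam T T' e _ ih => exact .lam T T' e ih
  | name a => exact .name a
  | tuple es Ts hlen _ ih => exact .tuple es Ts hlen ih
  | op o es hlen _ ih => exact .op o es hlen ih
  | app e e' T T' _ _ ih ih' => exact .app _ _ _ _ ih ih'
  | ite e e₁ e₂ T _ _ _ ih ih₁ ih₂ => exact .ite _ _ _ _ ih ih₁ ih₂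
  | new v e T T' hv _ _ ih ih' => exact .new _ _ _ _ hv ih ih'
  | deref l T h => exact .deref _ _ (LRef.ty_mono hS L' h)
  | assign l e T h _ ih => exact .assign _ _ _ (LRef.ty_mono hS L' h) ih
  | letIn Ts e e' T _ _ ih ih' => exact .letIn _ _ _ _ ih (List.append_assoc .. ▸ ih')

theorem HasTy.mono (hS : TyLe S S') {e : Exp O} {T : Ty} (h : HasTy S Δ L e T) :
    HasTy S' Δ L e T := by
  simpa using h.weaken hS [] []

theorem HasTy.inst_var {vs : List (Exp O)} {Us : List Ty}
    (hvs : List.Forall₂ (HasTy S [] []) vs Us) {n : ℕ} {T : Ty} (h : (Δ ++ Us)[n]? = some T) :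
    HasTy S Δ L (Exp.inst Δ.length vs (.var n)) T := by
  simp only [Exp.inst]
  split_ifs with hn
  · rw [List.getElem?_append_left hn] at h
    exact .var _ _ h
  · rw [List.getElem?_append_right (not_lt.1 hn)] at h
    obtain ⟨hU, rfl⟩ := List.getElem?_eq_some_iff.1 h
    have hv : n - Δ.length < vs.length := hvs.length_eq ▸ hU
    rw [List.getElem?_eq_getElem hv]
    exact (hvs.get hv hU).weaken (.refl S) Δ L

theorem HasTy.inst {vs : List (Exp O)} {Us : List Ty} (hv : ∀ v ∈ vs, IsVal v)
    (hvs : List.Forall₂ (HasTy S [] []) vs Us) {e : Exp O} {T : Ty}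
    (h : HasTy S (Δ ++ Us) L e T) : HasTy S Δ L (e.inst Δ.length vs) T := by
  generalize hΔ : Δ ++ Us = Δ₀ at h
  induction h generalizing Δ with
  | const c => exact .const c
  | var n T h => exact inst_var hvs (hΔ ▸ h)
  | lam T T' e _ ih => exact .lam T T' _ (ih (Δ := T :: .arr T T' :: Δ) (by simp [hΔ]))
  | name a => exact .name a
  | tuple es Ts hlen _ ih =>
    simp only [Exp.inst, Exp.insts_eq_map]
    exact .tuple_map hlen fun p hp => ih p hp hΔ
  | op o es hlen _ ih =>
    simp only [Exp.inst, Exp.insts_eq_map]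
    exact .op_map hlen fun p hp => ih p hp hΔ
  | app e e' T T' _ _ ih ih' => exact .app _ _ _ _ (ih hΔ) (ih' hΔ)
  | ite e e₁ e₂ T _ _ _ ih ih₁ ih₂ => exact .ite _ _ _ _ (ih hΔ) (ih₁ hΔ) (ih₂ hΔ)
  | new v e T T' hv' _ _ ih ih' => exact .new _ _ _ _ (hv'.inst hv _) (ih hΔ) (ih' hΔ)
  | deref l T h => exact .deref _ _ h
  | assign l e T h _ ih => exact .assign _ _ _ h (ih hΔ)
  | letIn Ts e e' T _ _ ih ih' =>
    have he' := ih' (Δ := Ts ++ Δ) (by simp [hΔ])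
    rw [List.length_append, add_comm] at he'
    exact .letIn _ _ _ _ (ih hΔ) he'

theorem HasTy.openLoc {l : ℕ} {U : Ty} (hl : S l = some U) {e : Exp O} {T : Ty}
    (h : HasTy S Δ (L ++ [U]) e T) : HasTy S Δ L (e.openLoc L.length l) T := by
  generalize hL : L ++ [U] = L₀ at h
  induction h generalizing L with
  | const c => exact .const c
  | var n T h => exact .var _ _ h
  | lam T T' e _ ih => exact .lam T T' _ (ih hL)
  | name a => exact .name a
  | tuple es Ts hlen _ ih =>
    simp only [Exp.openLoc, Exp.openLocs_eq_map]
    exact .tuple_map hlen fun p hp => ih p hp hL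
  | op o es hlen _ ih =>
    simp only [Exp.openLoc, Exp.openLocs_eq_map]
    exact .op_map hlen fun p hp => ih p hp hL
  | app e e' T T' _ _ ih ih' => exact .app _ _ _ _ (ih hL) (ih' hL)
  | ite e e₁ e₂ T _ _ _ ih ih₁ ih₂ => exact .ite _ _ _ _ (ih hL) (ih₁ hL) (ih₂ hL)
  | new v e T T' hv _ _ ih ih' =>
    exact .new _ _ _ _ (hv.openLoc _ _) (ih hL) (ih' (L := T :: L) (by simp [hL]))
  | deref r T h => exact .deref _ _ (LRef.ty_openAt hl (hL ▸ h))
  | assign r e T h _ ih => exact .assign _ _ _ (LRef.ty_openAt hl (hL ▸ h)) (ih hL)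
  | letIn Ts e e' T _ _ ih ih' => exact .letIn _ _ _ _ (ih hL) (ih' hL)

theorem HasTy.forall₂_replace {vs es : List (Exp O)} {e : Exp O} {Ts : List Ty}
    (h : List.Forall₂ (HasTy S Δ L) (vs ++ e :: es) Ts) : ∃ U, HasTy S Δ L e U ∧
      ∀ S' e', TyLe S S' → HasTy S' Δ L e' U →
        List.Forall₂ (HasTy S' Δ L) (vs ++ e' :: es) Ts := by
  induction vs generalizing Ts with
  | nil =>
    cases h with | cons he hes =>
    exact ⟨_, he, fun S' e' hS he' => .cons he' (hes.imp fun _ _ h => h.mono hS)⟩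
  | cons v vs ih =>
    cases h with | cons hv h =>
    obtain ⟨U, he, hU⟩ := ih h
    exact ⟨U, he, fun S' e' hS he' => .cons (hv.mono hS) (hU S' e' hS he')⟩

theorem ECtx.hasTy_fill (E : ECtx O) {e : Exp O} {T : Ty} (h : HasTy S [] [] (E.fill e) T) :
    ∃ U, HasTy S [] [] e U ∧
      ∀ S' e', TyLe S S' → HasTy S' [] [] e' U → HasTy S' [] [] (E.fill e') T := by
  induction E generalizing T with
  | hole => exact ⟨T, h, fun _ _ _ h => h⟩
  | tuple vs E es ih =>
    obtain ⟨Ts, rfl, hTs⟩ := hasTy_tuple_iff.1 h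
    obtain ⟨V, hV, hes⟩ := HasTy.forall₂_replace hTs
    obtain ⟨U, hU, hfill⟩ := ih hV
    exact ⟨U, hU, fun S' e' hS he' =>
      hasTy_tuple_iff.2 ⟨Ts, rfl, hes S' _ hS (hfill S' e' hS he')⟩⟩
  | op o vs E es ih =>
    obtain ⟨rfl, hTs⟩ := hasTy_op_iff.1 h
    obtain ⟨V, hV, hes⟩ := HasTy.forall₂_replace hTs
    obtain ⟨U, hU, hfill⟩ := ih hV
    exact ⟨U, hU, fun S' e' hS he' => hasTy_op_iff.2 ⟨rfl, hes S' _ hS (hfill S' e' hS he')⟩⟩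
  | appL E e ih =>
    cases h with | app _ _ _ _ h h' =>
    obtain ⟨U, hU, hfill⟩ := ih h
    exact ⟨U, hU, fun S' e' hS he' => .app _ _ _ _ (hfill S' e' hS he') (h'.mono hS)⟩
  | appR v E ih =>
    cases h with | app _ _ _ _ h h' =>
    obtain ⟨U, hU, hfill⟩ := ih h'
    exact ⟨U, hU, fun S' e' hS he' => .app _ _ _ _ (h.mono hS) (hfill S' e' hS he')⟩
  | assign l E ih =>
    cases h with | assign _ _ _ h h' =>
    obtain ⟨U, hU, hfill⟩ := ih h'
    exact ⟨U, hU, fun S' e' hS he' => .assign _ _ _ (LRef.ty_mono hS [] h) (hfill S' e' hS he')⟩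
  | ite E e₁ e₂ ih =>
    cases h with | ite _ _ _ _ h h₁ h₂ =>
    obtain ⟨U, hU, hfill⟩ := ih h
    exact ⟨U, hU, fun S' e' hS he' => .ite _ _ _ _ (hfill S' e' hS he') (h₁.mono hS) (h₂.mono hS)⟩
  | letIn n E e ih =>
    cases h with | letIn _ _ _ _ h h' =>
    obtain ⟨U, hU, hfill⟩ := ih h
    exact ⟨U, hU, fun S' e' hS he' => .letIn _ _ _ _ (hfill S' e' hS he') (h'.mono hS)⟩

theorem exists_hasTy_iff_eq (T : Ty) :
    ∃ e : Exp O, ∀ S Δ L U, HasTy S Δ L e U ↔ U = T := by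
  refine ⟨.app (.name ⟨0, .base .unit, T⟩) (.const .unit), fun S Δ L U => ⟨fun h => ?_, ?_⟩⟩
  · cases h with | app _ _ _ _ h _ =>
    cases h
    rfl
  · rintro rfl
    exact .app _ _ _ _ (.name _) (.const .unit)

theorem ECtx.hasTy_fill_mono (hS : TyLe S S') {E : ECtx O} {T T' : Ty}
    (h : ∀ e, HasTy S [] [] e T → HasTy S [] [] (E.fill e) T') (e : Exp O)
    (he : HasTy S' [] [] e T) : HasTy S' [] [] (E.fill e) T' := by
  -- `e` need not be typed in `S`, but the typing of `E` can be read off any expression of type `T`.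
  obtain ⟨e₀, he₀⟩ := exists_hasTy_iff_eq (O := O) T
  obtain ⟨U, hU, hfill⟩ := E.hasTy_fill (h e₀ ((he₀ ..).2 rfl))
  obtain rfl := (he₀ ..).1 hU
  exact hfill S' e hS he

end Typing

/-! ### Reduction -/

section StoreTyping

variable {s : Store O} {S : ℕ → Option Ty} {l : ℕ} {v : Exp O} {T : Ty}

theorem StoreTyping.insert (hs : StoreTyping s S) (hl : S l = some T) (hv : IsVal v)
    (h : HasTy S [] [] v T) : StoreTyping (s.insert l v) S where
  dom l' := by
    rw [hs.dom, Finmap.mem_insert, iff_or_self]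
    rintro rfl
    exact (hs.dom l').1 ⟨T, hl⟩
  typed l' v' T' h₁ h₂ := by
    rcases lookup_insert_eq_some.1 h₁ with ⟨rfl, rfl⟩ | ⟨-, h₁⟩
    · cases hl.symm.trans h₂
      exact ⟨hv, h⟩
    · exact hs.typed _ _ _ h₁ h₂

theorem StoreTyping.tyLe_update (hs : StoreTyping s S) (hl : l ∉ s) (T : Ty) :
    TyLe S (Function.update S l (some T)) := by
  intro l' T' h
  have hne : l' ≠ l := by
    rintro rfl
    exact hl ((hs.dom l').1 ⟨T', h⟩)
  rw [Function.update_of_ne hne, h]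

theorem StoreTyping.insert_update (hs : StoreTyping s S) (hl : l ∉ s) (hv : IsVal v)
    (h : HasTy S [] [] v T) : StoreTyping (s.insert l v) (Function.update S l (some T)) where
  dom l' := by
    by_cases hne : l' = l <;> simp [hs.dom, hne]
  typed l' v' T' h₁ h₂ := by
    have hle := hs.tyLe_update hl T
    rcases lookup_insert_eq_some.1 h₁ with ⟨rfl, rfl⟩ | ⟨hne, h₁⟩
    · rw [Function.update_self] at h₂
      cases h₂
      exact ⟨hv, h.mono hle⟩
    · rw [Function.update_of_ne hne] at h₂
      obtain ⟨hv', h'⟩ := hs.typed _ _ _ h₁ h₂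
      exact ⟨hv', h'.mono hle⟩

end StoreTyping

theorem HasTy.beta {S : ℕ → Option Ty} {T T' U U' : Ty} {e v : Exp O}
    (h : HasTy S [] [] (.lam T T' e) (.arr U U')) (hv : IsVal v) (hvU : HasTy S [] [] v U) :
    HasTy S [] [] (e.inst 0 [v, .lam T T' e]) U' := by
  have hlam := h
  cases h with | lam _ _ _ h =>
  exact .inst (Δ := []) (by simpa using ⟨hv, .lam _ _ _⟩) (.cons hvU (.cons hlam .nil)) h

section Reduction

variable {s s' s₀ : Store O} {e e' : Exp O}

theorem RedBase.preserves (h : RedBase s e s' e') {S : ℕ → Option Ty} (hs : StoreTyping s S)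
    {T : Ty} (he : HasTy S [] [] e T) :
    ∃ S', TyLe S S' ∧ StoreTyping s' S' ∧ HasTy S' [] [] e' T := by
  cases h with
  | op o cs w h =>
    obtain ⟨rfl, hcs⟩ := hasTy_op_iff.1 he
    have hw : w.ty = O.res o := O.eval_ty o cs w (forall₂_hasTy_const hcs) h
    exact ⟨S, .refl S, hs, hw ▸ .const w⟩
  | beta T₁ T₁' e v hv =>
    cases he with | app _ _ _ _ h h' =>
    exact ⟨S, .refl S, hs, h.beta hv h'⟩
  | letIn vs e hv =>
    generalize hn : vs.length = n at he
    cases he with | letIn Ts _ _ _ h h' =>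
    obtain ⟨_, hTs, hvs⟩ := hasTy_tuple_iff.1 h
    cases hTs
    exact ⟨S, .refl S, hs, .inst (Δ := []) hv hvs (by simpa using h')⟩
  | new l v e hv hl =>
    cases he with | new _ _ T₁ _ _ h h' =>
    have hle := hs.tyLe_update hl T₁
    exact ⟨_, hle, hs.insert_update hl hv h, .openLoc (L := []) (by simp) (h'.mono hle)⟩
  | deref l _ h =>
    cases he with | deref _ _ h' =>
    exact ⟨S, .refl S, hs, (hs.typed _ _ _ h h').2⟩
  | assign l v hv =>
    cases he with | assign _ _ _ h h' =>
    exact ⟨S, .refl S, hs.insert h hv h', .const .unit⟩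
  | iteTrue e₂ =>
    cases he with | ite _ _ _ _ _ h₁ h₂ =>
    exact ⟨S, .refl S, hs, h₁⟩
  | iteFalse e₁ =>
    cases he with | ite _ _ _ _ _ h₁ h₂ =>
    exact ⟨S, .refl S, hs, h₂⟩

theorem Red.preserves (h : Red s e s' e') {S : ℕ → Option Ty} (hs : StoreTyping s S) {T : Ty}
    (he : HasTy S [] [] e T) :
    ∃ S', TyLe S S' ∧ StoreTyping s' S' ∧ HasTy S' [] [] e' T := by
  cases h with | ctx E hE _ _ e e' h =>
  obtain ⟨U, hU, hfill⟩ := E.hasTy_fill he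
  obtain ⟨S', hS, hs', he'⟩ := h.preserves hs hU
  exact ⟨S', hS, hs', hfill S' e' hS he'⟩

theorem RedBase.names {A : Set Name} (h : RedBase s e s' e') (hs : AllValues (Exp.names · ⊆ A) s)
    (he : e.names ⊆ A) : AllValues (Exp.names · ⊆ A) s' ∧ e'.names ⊆ A := by
  cases h with
  | op o cs w h => exact ⟨hs, by simp [Exp.names]⟩
  | beta T T' e v hv =>
    simp only [Exp.names, Set.union_subset_iff] at he
    exact ⟨hs, Exp.names_inst_subset (by simpa [Exp.names] using he.symm) _ _ he.1⟩
  | letIn vs e hv =>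
    simp only [Exp.names, Set.union_subset_iff, Exp.namess_subset_iff] at he
    exact ⟨hs, Exp.names_inst_subset he.1 _ _ he.2⟩
  | new l v e hv hl =>
    simp only [Exp.names, Set.union_subset_iff] at he
    exact ⟨hs.insert he.1 l, e.names_openLoc 0 l ▸ he.2⟩
  | deref l _ h => exact ⟨hs, hs _ _ h⟩
  | assign l v hv =>
    simp only [Exp.names] at he
    exact ⟨hs.insert he l, by simp [Exp.names]⟩
  | iteTrue e₂ =>
    simp only [Exp.names, Set.union_subset_iff] at he
    exact ⟨hs, he.1.2⟩
  | iteFalse e₁ =>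
    simp only [Exp.names, Set.union_subset_iff] at he
    exact ⟨hs, he.2⟩

theorem Red.names {A : Set Name} (h : Red s e s' e') (hs : AllValues (Exp.names · ⊆ A) s)
    (he : e.names ⊆ A) : AllValues (Exp.names · ⊆ A) s' ∧ e'.names ⊆ A := by
  cases h with | ctx E hE _ _ e e' h =>
  rw [ECtx.names_fill_subset_iff] at he ⊢
  obtain ⟨hs', he'⟩ := h.names hs he.2
  exact ⟨hs', he.1, he'⟩

theorem RedBase.mem_store (h : RedBase s e s' e') {l : ℕ} (hl : l ∈ s) : l ∈ s' := by
  cases h <;> simp_all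

theorem Red.mem_store (h : Red s e s' e') {l : ℕ} (hl : l ∈ s) : l ∈ s' := by
  cases h with | ctx _ _ _ _ _ _ h => exact h.mem_store hl

theorem RedBase.frame (h : RedBase s e s' e') (hs : s'.Disjoint s₀) :
    RedBase (s ∪ s₀) e (s' ∪ s₀) e' := by
  cases h with
  | op o cs w h => exact .op _ _ _ _ h
  | beta T₁ T₁' e v hv => exact .beta _ _ _ _ _ hv
  | letIn vs e hv => exact .letIn _ _ _ hv
  | new l v e hv hl =>
    rw [← Finmap.insert_union]
    exact .new _ _ _ _ hv fun h => (Finmap.mem_union.1 h).elim hl (hs l (by simp))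
  | deref l _ h =>
    exact .deref _ _ _ (Finmap.lookup_union_left (Finmap.mem_of_lookup_eq_some h) ▸ h)
  | assign l v hv =>
    rw [← Finmap.insert_union]
    exact .assign _ _ _ hv
  | iteTrue e₂ => exact .iteTrue _ _ _
  | iteFalse e₁ => exact .iteFalse _ _ _

theorem Red.frame (h : Red s e s' e') (hs : s'.Disjoint s₀) :
    Red (s ∪ s₀) e (s' ∪ s₀) e' := by
  cases h with | ctx E hE _ _ e e' h => exact .ctx E hE _ _ _ _ (h.frame hs)

theorem RedBase.unframe (h : RedBase (s ∪ s₀) e s' e') (hd : s.Disjoint s₀)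
    {S : ℕ → Option Ty} (hs : StoreTyping s S) {T : Ty} (he : HasTy S [] [] e T) :
    ∃ s₁, RedBase s e s₁ e' ∧ s' = s₁ ∪ s₀ ∧ s₁.Disjoint s₀ := by
  cases h with
  | op o cs w h => exact ⟨s, .op _ _ _ _ h, rfl, hd⟩
  | beta T₁ T₁' e v hv => exact ⟨s, .beta _ _ _ _ _ hv, rfl, hd⟩
  | letIn vs e hv => exact ⟨s, .letIn _ _ _ hv, rfl, hd⟩
  | new l v e hv hl =>
    rw [Finmap.mem_union, not_or] at hl
    exact ⟨s.insert l v, .new _ _ _ _ hv hl.1, Finmap.insert_union,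
      disjoint_insert_left hd hl.2 v⟩
  | deref l _ h =>
    cases he with | deref _ _ h' =>
    rw [Finmap.lookup_union_left ((hs.dom l).1 ⟨_, h'⟩)] at h
    exact ⟨s, .deref _ _ _ h, rfl, hd⟩
  | assign l v hv =>
    cases he with | assign _ _ _ h' _ =>
    exact ⟨s.insert l v, .assign _ _ _ hv, Finmap.insert_union,
      disjoint_insert_left hd (hd l ((hs.dom l).1 ⟨_, h'⟩)) v⟩
  | iteTrue e₂ => exact ⟨s, .iteTrue _ _ _, rfl, hd⟩
  | iteFalse e₁ => exact ⟨s, .iteFalse _ _ _, rfl, hd⟩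

theorem Red.unframe (h : Red (s ∪ s₀) e s' e') (hd : s.Disjoint s₀)
    {S : ℕ → Option Ty} (hs : StoreTyping s S) {T : Ty} (he : HasTy S [] [] e T) :
    ∃ s₁, Red s e s₁ e' ∧ s' = s₁ ∪ s₀ ∧ s₁.Disjoint s₀ := by
  generalize hs₂ : s ∪ s₀ = s₂ at h
  cases h with | ctx E hE _ _ e e' h =>
  subst hs₂
  obtain ⟨U, hU, -⟩ := E.hasTy_fill he
  obtain ⟨s₁, h₁, h₂, h₃⟩ := h.unframe hd hs hU
  exact ⟨s₁, .ctx E hE _ _ _ _ h₁, h₂, h₃⟩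

end Reduction

/-! ### Ultimate patterns -/

theorem Pat.isVal_fill {Γ : Env O} (D : Pat)
    (h : ∀ i T T', (i, T, T') ∈ D.holes → ∃ w, Γ.lookup i = some w ∧ IsFun w T T') :
    IsVal (D.fill Γ) := by
  induction D using Pat.induct with
  | const c => exact .const c
  | hole i T T' =>
    obtain ⟨w, hw, hf⟩ := h i T T' (by simp [Pat.holes])
    simpa [Pat.fill, hw] using hf.isVal
  | tuple Ds ih =>
    simp only [Pat.fill, Pat.fills_eq_map]
    refine .tuple _ (List.forall_mem_map.2 fun D hD => ih D hD fun i T T' hi => h i T T' ?_)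
    exact Pat.mem_holess.2 ⟨D, hD, hi⟩

theorem Pat.forall_lookup_of_fill {P : Exp O → Prop}
    (hP : ∀ es, P (.tuple es) → ∀ e ∈ es, P e) {Γ : Env O} (D : Pat) (hD : P (D.fill Γ))
    {p : ℕ × Ty × Ty} (hp : p ∈ D.holes) {w : Exp O} (hw : Γ.lookup p.1 = some w) : P w := by
  induction D using Pat.induct with
  | const c => simp [Pat.holes] at hp
  | hole i T T' =>
    simp only [Pat.holes, List.mem_singleton] at hp
    subst hp
    simpa [Pat.fill, hw] using hD
  | tuple Ds ih =>
    obtain ⟨D, hDs, hp⟩ := Pat.mem_holess.1 hp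
    simp only [Pat.fill, Pat.fills_eq_map] at hD
    exact ih D hDs (hP _ hD _ (List.mem_map_of_mem hDs)) hp

theorem UltPat.isVal {v : Exp O} {D : Pat} {Γ : Env O} (h : UltPat v D Γ) : IsVal v :=
  h.fill ▸ D.isVal_fill h.isFun

theorem UltPat.allValues {P : Exp O → Prop} (hP : ∀ es, P (.tuple es) → ∀ e ∈ es, P e)
    {v : Exp O} {D : Pat} {Γ : Env O} (h : UltPat v D Γ) (hv : P v) : AllValues P Γ := by
  intro i w hw
  obtain ⟨p, hp, rfl⟩ := List.mem_map.1 ((h.dom i).1 (Finmap.mem_of_lookup_eq_some hw))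
  exact D.forall_lookup_of_fill hP (h.fill ▸ hv) hp hw

theorem OppVal.isVal {T : Ty} {u : Exp O} (h : OppVal T u) : IsVal u := by
  obtain ⟨D, as, h, -⟩ := h
  exact h.isVal

theorem OppVal.hasTy {T : Ty} {u : Exp O} (h : OppVal T u) (S : ℕ → Option Ty) :
    HasTy S [] [] u T := by
  obtain ⟨D, as, -, -, -, h⟩ := h
  exact h.mono (by simp [TyLe])

/-- `v` is a closed value that is well typed in the store typing `S`. -/
def TypedVal (S : ℕ → Option Ty) (v : Exp O) : Prop :=
  IsVal v ∧ ∃ T, HasTy S [] [] v T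

theorem TypedVal.mono {S S' : ℕ → Option Ty} (hS : TyLe S S') {v : Exp O} (h : TypedVal S v) :
    TypedVal S' v :=
  h.imp_right (Exists.imp fun _ => HasTy.mono hS)

theorem TypedVal.of_mem_tuple {S : ℕ → Option Ty} {es : List (Exp O)}
    (h : TypedVal S (.tuple es)) : ∀ e ∈ es, TypedVal S e := by
  obtain ⟨hv, T, hT⟩ := h
  obtain ⟨Ts, -, hTs⟩ := hasTy_tuple_iff.1 hT
  intro e he
  obtain ⟨n, hn, rfl⟩ := List.getElem_of_mem he
  cases hv with | tuple _ hv =>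
  exact ⟨hv _ he, _, hTs.get hn (hTs.length_eq ▸ hn)⟩

theorem UltPat.typedVal {v : Exp O} {D : Pat} {Γ : Env O} (h : UltPat v D Γ)
    {S : ℕ → Option Ty} {T : Ty} (hT : HasTy S [] [] v T) : AllValues (TypedVal S) Γ :=
  h.allValues (fun _ => TypedVal.of_mem_tuple) ⟨h.isVal, T, hT⟩

theorem UltPat.names {v : Exp O} {D : Pat} {Γ : Env O} (h : UltPat v D Γ) {A : Set Name}
    (hA : v.names ⊆ A) : AllValues (Exp.names · ⊆ A) Γ :=
  h.allValues (P := (Exp.names · ⊆ A)) (fun _ => Exp.namess_subset_iff.1) hA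

/-! ### Renaming of locations -/

/-- Rename a free location. -/
def LRef.ren (ρ : ℕ → ℕ) : LRef → LRef
  | .free l => .free (ρ l)
  | .bound k => .bound k

mutual
/-- Rename the free locations of an expression. -/
def Exp.ren (ρ : ℕ → ℕ) : Exp O → Exp O
  | .const c => .const c
  | .var n => .var n
  | .lam T T' e => .lam T T' (e.ren ρ)
  | .name a => .name a
  | .tuple es => .tuple (Exp.rens ρ es)
  | .op o es => .op o (Exp.rens ρ es)
  | .app e e' => .app (e.ren ρ) (e'.ren ρ)
  | .ite e e₁ e₂ => .ite (e.ren ρ) (e₁.ren ρ) (e₂.ren ρ)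
  | .new v e => .new (v.ren ρ) (e.ren ρ)
  | .deref r => .deref (r.ren ρ)
  | .assign r e => .assign (r.ren ρ) (e.ren ρ)
  | .letIn n e e' => .letIn n (e.ren ρ) (e'.ren ρ)
/-- `Exp.ren` on lists of expressions. -/
def Exp.rens (ρ : ℕ → ℕ) : List (Exp O) → List (Exp O)
  | [] => []
  | e :: es => e.ren ρ :: Exp.rens ρ es
end

theorem Exp.rens_eq_map (ρ : ℕ → ℕ) (es : List (Exp O)) :
    Exp.rens ρ es = es.map (Exp.ren ρ) := by
  induction es with
  | nil => simp [Exp.rens]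
  | cons e es ih => simp [Exp.rens, ih]

/-- Rename the free locations of an evaluation context. -/
def ECtx.ren (ρ : ℕ → ℕ) : ECtx O → ECtx O
  | .hole => .hole
  | .tuple vs E es => .tuple (vs.map (Exp.ren ρ)) (E.ren ρ) (es.map (Exp.ren ρ))
  | .op o vs E es => .op o (vs.map (Exp.ren ρ)) (E.ren ρ) (es.map (Exp.ren ρ))
  | .appL E e => .appL (E.ren ρ) (e.ren ρ)
  | .appR v E => .appR (v.ren ρ) (E.ren ρ)
  | .assign l E => .assign (l.ren ρ) (E.ren ρ)
  | .ite E e₁ e₂ => .ite (E.ren ρ) (e₁.ren ρ) (e₂.ren ρ)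
  | .letIn n E e => .letIn n (E.ren ρ) (e.ren ρ)

/-- Rename the locations in the values of an environment. -/
def Env.ren (ρ : ℕ → ℕ) (Γ : Env O) : Env O := mapFinmap (.refl ℕ) (Exp.ren ρ) Γ

theorem Env.lookup_ren (ρ : ℕ → ℕ) (Γ : Env O) (i : ℕ) :
    (Env.ren ρ Γ).lookup i = (Γ.lookup i).map (Exp.ren ρ) :=
  lookup_mapFinmap (.refl ℕ) _ Γ i

theorem Env.mem_ren {ρ : ℕ → ℕ} {Γ : Env O} {i : ℕ} : i ∈ Env.ren ρ Γ ↔ i ∈ Γ := by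
  simp [Env.ren, mem_mapFinmap]

theorem IsVal.ren (ρ : ℕ → ℕ) {v : Exp O} (hv : IsVal v) : IsVal (v.ren ρ) := by
  induction hv with
  | tuple es h ih =>
    simp only [Exp.ren, Exp.rens_eq_map]
    exact .tuple _ (List.forall_mem_map.2 ih)
  | _ => constructor

theorem IsFun.ren (ρ : ℕ → ℕ) {v : Exp O} {T T' : Ty} (h : IsFun v T T') :
    IsFun (v.ren ρ) T T' := by
  cases h <;> constructor

theorem Exp.ren_inst (ρ : ℕ → ℕ) (vs : List (Exp O)) (e : Exp O) (k : ℕ) :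
    (e.inst k vs).ren ρ = (e.ren ρ).inst k (vs.map (Exp.ren ρ)) := by
  induction e using Exp.induct generalizing k with
  | var n =>
    simp only [Exp.inst, Exp.ren]
    split_ifs
    · simp [Exp.ren]
    · cases h : vs[n - k]? <;> simp [h, Exp.ren]
  | tuple es ih | op o es ih =>
    simp only [Exp.inst, Exp.insts_eq_map, Exp.ren, Exp.rens_eq_map, List.map_map]
    congr 1
    exact List.map_congr_left fun e he => ih e he k
  | _ => simp_all [Exp.inst, Exp.ren]

theorem LRef.ren_openAt (ρ : ℕ → ℕ) (r : LRef) (k l : ℕ) :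
    (r.openAt k l).ren ρ = (r.ren ρ).openAt k (ρ l) := by
  cases r with
  | free l' => rfl
  | bound j => simp only [LRef.openAt, LRef.ren]; split_ifs <;> rfl

theorem Exp.ren_openLoc (ρ : ℕ → ℕ) (e : Exp O) (k l : ℕ) :
    (e.openLoc k l).ren ρ = (e.ren ρ).openLoc k (ρ l) := by
  induction e using Exp.induct generalizing k with
  | tuple es ih | op o es ih =>
    simp only [Exp.openLoc, Exp.openLocs_eq_map, Exp.ren, Exp.rens_eq_map, List.map_map]
    congr 1
    exact List.map_congr_left fun e he => ih e he k
  | _ => simp_all [Exp.openLoc, Exp.ren, LRef.ren_openAt]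

theorem ECtx.ren_fill (ρ : ℕ → ℕ) (E : ECtx O) (e : Exp O) :
    (E.fill e).ren ρ = (E.ren ρ).fill (e.ren ρ) := by
  induction E <;> simp_all [ECtx.fill, ECtx.ren, Exp.ren, Exp.rens_eq_map]

theorem ECtx.Valid.ren (ρ : ℕ → ℕ) {E : ECtx O} (h : E.Valid) : (E.ren ρ).Valid := by
  induction E with
  | tuple vs E es ih | op o vs E es ih =>
    exact ⟨List.forall_mem_map.2 fun v hv => (h.1 v hv).ren ρ, ih h.2⟩
  | hole => trivial
  | appR v E ih => exact ⟨h.1.ren ρ, ih h.2⟩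
  | appL E e ih | assign l E ih | ite E e₁ e₂ ih | letIn n E e ih => exact ih h

theorem LRef.ty_ren {ρ : ℕ → ℕ} {S S' : ℕ → Option Ty}
    (h : TyLe S (S' ∘ ρ)) {L : List Ty} {r : LRef} {T : Ty}
    (hr : r.ty S L = some T) : (r.ren ρ).ty S' L = some T := by
  cases r with
  | free l => exact h l T hr
  | bound k => exact hr

theorem HasTy.ren {ρ : ℕ → ℕ} {S S' : ℕ → Option Ty} (hS : TyLe S (S' ∘ ρ))
    {Δ L : List Ty} {e : Exp O} {T : Ty} (h : HasTy S Δ L e T) : HasTy S' Δ L (e.ren ρ) T := by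
  induction h with
  | const c => exact .const c
  | var n T h => exact .var _ _ h
  | lam T T' e _ ih => exact .lam T T' _ ih
  | name a => exact .name a
  | tuple es Ts hlen _ ih => simp only [Exp.ren, Exp.rens_eq_map]; exact .tuple_map hlen ih
  | op o es hlen _ ih => simp only [Exp.ren, Exp.rens_eq_map]; exact .op_map hlen ih
  | app e e' T T' _ _ ih ih' => exact .app _ _ _ _ ih ih'
  | ite e e₁ e₂ T _ _ _ ih ih₁ ih₂ => exact .ite _ _ _ _ ih ih₁ ih₂
  | new v e T T' hv _ _ ih ih' => exact .new _ _ _ _ (hv.ren ρ) ih ih'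
  | deref r T h => exact .deref _ _ (LRef.ty_ren hS h)
  | assign r e T h _ ih => exact .assign _ _ _ (LRef.ty_ren hS h) ih
  | letIn Ts e e' T _ _ ih ih' => exact .letIn _ _ _ _ ih ih'

theorem LRef.ren_eq_self {ρ : ℕ → ℕ} {S : ℕ → Option Ty} (hρ : ∀ l T, S l = some T → ρ l = l)
    {L : List Ty} {r : LRef} {T : Ty} (hr : r.ty S L = some T) : r.ren ρ = r := by
  cases r with
  | free l => simp only [LRef.ren, hρ l T hr]
  | bound k => rfl

theorem map_eq_self_of_forall_mem_zip {α β : Type*} {f : α → α} {l : List α} {m : List β}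
    (hlen : l.length = m.length) (h : ∀ p ∈ l.zip m, f p.1 = p.1) : l.map f = l := by
  induction l generalizing m with
  | nil => rfl
  | cons a l ih =>
    cases m with
    | nil => simp at hlen
    | cons b m =>
      simp only [List.zip_cons_cons, List.mem_cons, forall_eq_or_imp] at h
      simp [h.1, ih (by simpa using hlen) h.2]

theorem HasTy.ren_eq_self {ρ : ℕ → ℕ} {S : ℕ → Option Ty} (hρ : ∀ l T, S l = some T → ρ l = l)
    {Δ L : List Ty} {e : Exp O} {T : Ty} (h : HasTy S Δ L e T) : e.ren ρ = e := by
  induction h with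
  | tuple es Ts hlen _ ih | op o es hlen _ ih =>
    simp only [Exp.ren, Exp.rens_eq_map, map_eq_self_of_forall_mem_zip hlen ih]
  | deref r T h => simp only [Exp.ren, LRef.ren_eq_self hρ h]
  | assign r e T h _ ih => simp only [Exp.ren, LRef.ren_eq_self hρ h, ih]
  | _ => simp_all [Exp.ren]

theorem ECtx.ren_eq_self {ρ : ℕ → ℕ} (E : ECtx O) {e : Exp O}
    (h : (E.fill e).ren ρ = E.fill e) : E.ren ρ = E := by
  induction E with
  | hole => rfl
  | tuple vs E es ih | op o vs E es ih =>
    simp only [ECtx.fill, Exp.ren, Exp.rens_eq_map, List.map_append, List.map_cons,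
      Exp.tuple.injEq, Exp.op.injEq, true_and] at h
    obtain ⟨h₁, h₂⟩ := List.append_inj h (by simp)
    simp only [List.cons.injEq] at h₂
    simp [ECtx.ren, h₁, h₂.2, ih h₂.1]
  | _ => simp_all [ECtx.fill, ECtx.ren, Exp.ren]

theorem Pat.fill_ren (ρ : ℕ → ℕ) {Γ : Env O} (D : Pat) :
    D.fill (Env.ren ρ Γ) = (D.fill Γ).ren ρ := by
  induction D using Pat.induct with
  | const c => simp [Pat.fill, Exp.ren]
  | hole i T T' =>
    simp only [Pat.fill, Env.lookup_ren]
    cases Γ.lookup i <;> simp [Exp.ren]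
  | tuple Ds ih =>
    simp only [Pat.fill, Pat.fills_eq_map, Exp.ren, Exp.rens_eq_map, List.map_map]
    congr 1
    exact List.map_congr_left ih

theorem UltPat.ren (ρ : ℕ → ℕ) {v : Exp O} {D : Pat} {Γ : Env O} (h : UltPat v D Γ) :
    UltPat (v.ren ρ) D (Env.ren ρ Γ) where
  nodup := h.nodup
  dom i := by rw [Env.mem_ren, h.dom]
  isFun i T T' hi := by
    obtain ⟨w, hw, hf⟩ := h.isFun i T T' hi
    exact ⟨w.ren ρ, by simp [Env.lookup_ren, hw], hf.ren ρ⟩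
  fill := by rw [Pat.fill_ren, h.fill]

theorem OppVal.ren_eq_self (ρ : ℕ → ℕ) {T : Ty} {u : Exp O} (h : OppVal T u) : u.ren ρ = u := by
  obtain ⟨D, as, -, -, -, h⟩ := h
  exact h.ren_eq_self (by simp)

theorem FunRed.ren (ρ : ℕ → ℕ) {v u e : Exp O} (h : FunRed v u e) :
    FunRed (v.ren ρ) (u.ren ρ) (e.ren ρ) := by
  cases h with
  | name a => exact .name _ _
  | lam T T' e =>
    simp only [Exp.ren, Exp.ren_inst, List.map_cons, List.map_nil]
    exact .lam _ _ _ _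

/-- Rename the locations of a store. -/
def Store.ren (ρ : ℕ ↪ ℕ) (s : Store O) : Store O := mapFinmap ρ (Exp.ren ρ) s

theorem RedBase.ren (ρ : ℕ ↪ ℕ) {s s' : Store O} {e e' : Exp O} (h : RedBase s e s' e') :
    RedBase (Store.ren ρ s) (e.ren ρ) (Store.ren ρ s') (e'.ren ρ) := by
  cases h with
  | op o cs w h =>
    have : (cs.map Exp.const).map (Exp.ren ρ) = cs.map (Exp.const (O := O)) := by
      simp [Function.comp_def, Exp.ren]
    simp only [Exp.ren, Exp.rens_eq_map, this]
    exact .op _ _ _ _ h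
  | beta T₁ T₁' e v hv =>
    simp only [Exp.ren, Exp.ren_inst, List.map_cons, List.map_nil]
    exact .beta _ _ _ _ _ (hv.ren ρ)
  | letIn vs e hv =>
    simp only [Exp.ren, Exp.ren_inst, Exp.rens_eq_map]
    simpa using RedBase.letIn (Store.ren ρ s) (vs.map (Exp.ren ρ)) (e.ren ρ)
      (List.forall_mem_map.2 fun v hm => (hv v hm).ren ρ)
  | new l v e hv hl =>
    simp only [Exp.ren, Exp.ren_openLoc, Store.ren, mapFinmap_insert]
    refine .new _ _ _ _ (hv.ren ρ) (mt apply_mem_mapFinmap.1 hl)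
  | deref l _ h =>
    simp only [Exp.ren, LRef.ren]
    exact .deref _ _ _ (by rw [Store.ren, lookup_mapFinmap, h, Option.map_some])
  | assign l v hv =>
    simp only [Exp.ren, LRef.ren, Store.ren, mapFinmap_insert]
    exact .assign _ _ _ (hv.ren ρ)
  | iteTrue e₂ => exact .iteTrue _ _ _
  | iteFalse e₁ => exact .iteFalse _ _ _

theorem Red.ren (ρ : ℕ ↪ ℕ) {s s' : Store O} {e e' : Exp O} (h : Red s e s' e') :
    Red (Store.ren ρ s) (e.ren ρ) (Store.ren ρ s') (e'.ren ρ) := by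
  cases h with | ctx E hE _ _ e e' h =>
  rw [ECtx.ren_fill, ECtx.ren_fill]
  exact .ctx _ (hE.ren ρ) _ _ _ _ (h.ren ρ)

theorem tyLe_extend_comp (ρ : ℕ ↪ ℕ) (S : ℕ → Option Ty) :
    TyLe S (Function.extend ρ S (fun _ => none) ∘ ρ) :=
  fun l _ h => (ρ.injective.extend_apply S _ l).trans h

theorem StoreTyping.ren (ρ : ℕ ↪ ℕ) {s : Store O} {S : ℕ → Option Ty} (h : StoreTyping s S) :
    StoreTyping (Store.ren ρ s) (Function.extend ρ S fun _ => none) where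
  dom l := by
    by_cases hl : ∃ l', ρ l' = l
    · obtain ⟨l, rfl⟩ := hl
      rw [ρ.injective.extend_apply, h.dom, Store.ren, apply_mem_mapFinmap]
    · rw [Function.extend_apply' _ _ _ hl, Store.ren, mem_mapFinmap]
      grind
  typed l v T hv hT := by
    obtain ⟨l, v, hl, rfl, rfl⟩ := lookup_mapFinmap_eq_some.1 hv
    rw [ρ.injective.extend_apply] at hT
    obtain ⟨h₁, h₂⟩ := h.typed l v T hl hT
    exact ⟨h₁.ren ρ, h₂.ren (tyLe_extend_comp ρ S)⟩

/-- Rename the locations of a frame. -/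
def Frame.ren (ρ : ℕ → ℕ) (F : Frame O) : Frame O := ⟨F.holeTy, F.ctx.ren ρ⟩

/-- Rename the locations of a configuration. -/
def Conf.ren (ρ : ℕ ↪ ℕ) : Conf O → Conf O
  | .bot => .bot
  | .mk A Γ K s e => .mk A (Env.ren ρ Γ) (K.map (Frame.ren ρ)) (Store.ren ρ s) (e.map (Exp.ren ρ))

theorem Trans.ren (ρ : ℕ ↪ ℕ) {C C' : Conf O} {η : Label O} (h : Trans C η C') :
    Trans (C.ren ρ) η (C'.ren ρ) := by
  cases h with
  | propApp A Γ Γ' K s E a v D hE hv hD hΓ =>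
    simp only [Conf.ren, Option.map_some, ECtx.ren_fill, Exp.ren, Env.ren, mapFinmap_union]
    exact .propApp _ _ _ _ _ _ _ _ _ (hE.ren ρ) (hv.ren ρ) (hD.ren ρ) (disjoint_mapFinmap _ _ hΓ)
  | propRet A Γ Γ' K s v D hv hD hΓ =>
    simp only [Conf.ren, Option.map_some, Env.ren, mapFinmap_union]
    exact .propRet _ _ _ _ _ _ _ (hv.ren ρ) (hD.ren ρ) (disjoint_mapFinmap _ _ hΓ)
  | opApp A Γ K s S i v u e T T' hi hS hT hu hA he =>
    refine .opApp _ _ _ _ _ i (v.ren ρ) u (e.ren ρ) T T' (by rw [Env.lookup_ren, hi]; rfl)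
      (hS.ren ρ) (hT.ren (tyLe_extend_comp ρ S)) hu hA ?_
    simpa [hu.ren_eq_self] using he.ren ρ
  | opRet A Γ K s T E u hu hA =>
    simp only [Conf.ren, Option.map_some, ECtx.ren_fill, hu.ren_eq_self]
    exact .opRet _ _ _ _ _ _ _ hu hA
  | tau A Γ K s s' e e' h => exact .tau _ _ _ _ _ _ _ (h.ren ρ)
  | response C η h => exact .response _ _ h
  | term A Γ s => exact .term _ _ _

theorem TauStar.ren (ρ : ℕ ↪ ℕ) {C C' : Conf O} (h : TauStar C C') :
    TauStar (C.ren ρ) (C'.ren ρ) :=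
  Relation.ReflTransGen.lift (Conf.ren ρ) (fun _ _ (h : Trans _ .tau _) => h.ren ρ) _ _ h

theorem WTrans.ren (ρ : ℕ ↪ ℕ) {C C' : Conf O} {η : Label O} (h : WTrans C η C') :
    WTrans (C.ren ρ) η (C'.ren ρ) := by
  obtain ⟨rfl, h⟩ | ⟨hη, C₁, C₂, h₁, h₂, h₃⟩ := h
  · exact .inl ⟨rfl, h.ren ρ⟩
  · exact .inr ⟨hη, _, _, h₁.ren ρ, h₂.ren ρ, h₃.ren ρ⟩

/-! ### Transitions -/

/-- Opponent configurations, those in which no expression is being evaluated. -/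
def Conf.IsOpp : Conf O → Prop
  | .mk _ _ _ _ none => True
  | _ => False

/-- The domain of the store of a configuration. -/
def Conf.storeDom : Conf O → Finset ℕ
  | .bot => ∅
  | .mk _ _ _ s _ => s.keys

/-- The abstract names introduced by a label. -/
def Label.names : Label O → Set Name
  | .oapp _ u => u.names
  | .oret u => u.names
  | _ => ∅

/-- The indices introduced by a label. -/
def Label.holes : Label O → Finset ℕ
  | .papp _ D => (D.holes.map Prod.fst).toFinset
  | .pret D => (D.holes.map Prod.fst).toFinset
  | _ => ∅

/-- Opponent labels: apart from responses, only opponent configurations have transitions with such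
a label. -/
def Label.IsOpp : Label O → Prop
  | .oapp _ _ | .oret _ | .term => True
  | _ => False

theorem UltPat.keys {v : Exp O} {D : Pat} {Γ : Env O} (h : UltPat v D Γ) :
    Γ.keys = (D.holes.map Prod.fst).toFinset := by
  ext i
  rw [Finmap.mem_keys, h.dom, List.mem_toFinset]

section Transitions

variable {C C' : Conf O} {η : Label O}

theorem Trans.of_bot (h : Trans .bot η C) : C = .bot ∧ η ≠ .term := by
  cases h with | response _ _ h => exact ⟨rfl, h⟩

theorem Trans.ne_bot (h : Trans C η C') (hC' : C' ≠ .bot) : C ≠ .bot := by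
  rintro rfl
  exact hC' h.of_bot.1

theorem Trans.ne_term (h : Trans C η C') (hC' : C' ≠ .bot) : η ≠ .term := by
  rintro rfl
  cases h <;> exact hC' rfl

theorem Trans.envDom (h : Trans C η C') (hC' : C' ≠ .bot) : C'.envDom = C.envDom ∪ η.holes := by
  cases h with
  | propApp _ _ _ _ _ _ _ _ _ _ _ hD | propRet _ _ _ _ _ _ _ _ hD =>
    simp only [Conf.envDom, Label.holes, Finmap.keys_union, hD.keys]
  | response | term => exact absurd rfl hC'
  | _ => simp [Conf.envDom, Label.holes]

theorem Trans.used (h : Trans C η C') (hC' : C' ≠ .bot) : C'.used = C.used ∪ η.names := by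
  cases h with
  | response | term => exact absurd rfl hC'
  | _ => simp [Conf.used, Label.names]

theorem Trans.storeDom_subset (h : Trans C η C') (hC' : C' ≠ .bot) : C.storeDom ⊆ C'.storeDom := by
  cases h with
  | tau _ _ _ _ _ _ _ h =>
    exact fun l hl => Finmap.mem_keys.2 (h.mem_store (Finmap.mem_keys.1 hl))
  | response | term => exact absurd rfl hC'
  | _ => exact subset_rfl

theorem Trans.isOpp_iff (h : Trans C .tau C') (hC' : C' ≠ .bot) : C'.IsOpp ↔ C.IsOpp := by
  cases h with
  | response => exact absurd rfl hC'
  | tau => simp [Conf.IsOpp]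

theorem Trans.label_isOpp (h : Trans C η C') (hC : C.IsOpp) :
    C' = .bot ∧ η ≠ .term ∨ η.IsOpp := by
  cases h with
  | response _ _ h => exact .inl ⟨rfl, h⟩
  | propApp | propRet | tau => simp [Conf.IsOpp] at hC
  | _ => simp [Label.IsOpp]

theorem Trans.isOpp_of_label (h : Trans C η C') (hη : η.IsOpp) (hC' : C' ≠ .bot ∨ η = .term) :
    C.IsOpp := by
  cases h with
  | response _ _ h => simp_all
  | propApp | propRet | tau => simp [Label.IsOpp] at hη
  | _ => simp [Conf.IsOpp]

theorem TauStar.ne_bot (h : TauStar C C') (hC' : C' ≠ .bot) : C ≠ .bot := by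
  induction h using Relation.ReflTransGen.head_induction_on with
  | refl => exact hC'
  | head h _ ih => exact Trans.ne_bot h ih

theorem TauStar.of_bot (h : TauStar .bot C) : C = .bot := by
  by_contra hC
  exact h.ne_bot hC rfl

theorem TauStar.lift {r : Conf O → Conf O → Prop} (refl : ∀ C, r C C)
    (trans : ∀ C₁ C₂ C₃, r C₁ C₂ → r C₂ C₃ → r C₁ C₃)
    (step : ∀ C C', Trans C .tau C' → C' ≠ .bot → r C C') (h : TauStar C C') (hC' : C' ≠ .bot) :
    r C C' := by
  induction h using Relation.ReflTransGen.head_induction_on with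
  | refl => exact refl _
  | head h h' ih => exact trans _ _ _ (step _ _ h (TauStar.ne_bot h' hC')) ih

theorem TauStar.envDom (h : TauStar C C') (hC' : C' ≠ .bot) : C'.envDom = C.envDom :=
  h.lift (r := fun C C' => C'.envDom = C.envDom) (fun _ => rfl) (fun _ _ _ h₁ h₂ => h₂.trans h₁)
    (fun _ _ h hC' => by simpa [Label.holes] using h.envDom hC') hC'

theorem TauStar.used (h : TauStar C C') (hC' : C' ≠ .bot) : C'.used = C.used :=
  h.lift (r := fun C C' => C'.used = C.used) (fun _ => rfl) (fun _ _ _ h₁ h₂ => h₂.trans h₁)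
    (fun _ _ h hC' => by simpa [Label.names] using h.used hC') hC'

theorem TauStar.storeDom_subset (h : TauStar C C') (hC' : C' ≠ .bot) : C.storeDom ⊆ C'.storeDom :=
  h.lift (r := fun C C' => C.storeDom ⊆ C'.storeDom) (fun _ => subset_rfl)
    (fun _ _ _ => subset_trans) (fun _ _ => Trans.storeDom_subset) hC'

theorem TauStar.isOpp_iff (h : TauStar C C') (hC' : C' ≠ .bot) : C'.IsOpp ↔ C.IsOpp :=
  h.lift (r := fun C C' => C'.IsOpp ↔ C.IsOpp) (fun _ => .rfl) (fun _ _ _ h₁ h₂ => h₂.trans h₁)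
    (fun _ _ => Trans.isOpp_iff) hC'

theorem Trans.weak (h : Trans C η C') : WTrans C η C' := by
  by_cases hη : η = .tau
  · subst hη
    exact .inl ⟨rfl, .single h⟩
  · exact .inr ⟨hη, C, C', .refl, h, .refl⟩

theorem WTrans.response (C : Conf O) (hη : η ≠ .term) : WTrans C η .bot :=
  (Trans.response C η hη).weak

theorem WTrans.of_bot (h : WTrans .bot η C) : C = .bot ∧ η ≠ .term := by
  obtain ⟨rfl, h⟩ | ⟨-, C₁, C₂, h₁, h₂, h₃⟩ := h
  · exact ⟨h.of_bot, by simp⟩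
  · obtain rfl := h₁.of_bot
    obtain ⟨rfl, hη⟩ := h₂.of_bot
    exact ⟨h₃.of_bot, hη⟩

theorem WTrans.envDom (h : WTrans C η C') (hC' : C' ≠ .bot) : C'.envDom = C.envDom ∪ η.holes := by
  obtain ⟨rfl, h⟩ | ⟨-, C₁, C₂, h₁, h₂, h₃⟩ := h
  · simpa [Label.holes] using h.envDom hC'
  · have hC₂ := h₃.ne_bot hC'
    rw [h₃.envDom hC', h₂.envDom hC₂, h₁.envDom (h₂.ne_bot hC₂)]

theorem WTrans.used (h : WTrans C η C') (hC' : C' ≠ .bot) : C'.used = C.used ∪ η.names := by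
  obtain ⟨rfl, h⟩ | ⟨-, C₁, C₂, h₁, h₂, h₃⟩ := h
  · simpa [Label.names] using h.used hC'
  · have hC₂ := h₃.ne_bot hC'
    rw [h₃.used hC', h₂.used hC₂, h₁.used (h₂.ne_bot hC₂)]

theorem WTrans.isOpp_of_label (h : WTrans C η C') (hη : η.IsOpp) (hC' : C' ≠ .bot ∨ η = .term) :
    C.IsOpp := by
  obtain ⟨rfl, -⟩ | ⟨-, C₁, C₂, h₁, h₂, h₃⟩ := h
  · simp [Label.IsOpp] at hη
  · have hC₁ := h₂.isOpp_of_label hη (hC'.imp_left h₃.ne_bot)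
    exact (h₁.isOpp_iff (by rintro rfl; exact hC₁)).1 hC₁

end Transitions

/-! ### Well-formed configurations -/

theorem FunRed.hasTy_arr {v u e : Exp O} (h : FunRed v u e) {S S' : ℕ → Option Ty} {T T' U : Ty}
    (hT : HasTy S [] [] v (.arr T T')) (hU : HasTy S' [] [] v U) :
    HasTy S' [] [] v (.arr T T') := by
  cases h <;> cases hT <;> cases hU
  · exact .name _
  · exact .lam _ _ _ ‹_›

theorem FunRed.hasTy {v u e : Exp O} (h : FunRed v u e) {S : ℕ → Option Ty} {T T' : Ty}
    (hv : HasTy S [] [] v (.arr T T')) (hu : HasTy S [] [] u T) (hval : IsVal u) :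
    HasTy S [] [] e T' := by
  cases h with
  | name a => exact .app _ _ _ _ hv hu
  | lam T₁ T₁' e => exact hv.beta hval hu

theorem FunRed.names {v u e : Exp O} (h : FunRed v u e) {A : Set Name} (hv : v.names ⊆ A)
    (hu : u.names ⊆ A) : e.names ⊆ A := by
  cases h with
  | name a => exact Set.union_subset hv hu
  | lam T₁ T₁' e => exact Exp.names_inst_subset (by simpa using ⟨hu, hv⟩) _ _ hv

theorem Label.finite_names (η : Label O) : η.names.Finite := by
  cases η <;> simp [Label.names, Exp.finite_names]

/-- The frame `F` is an evaluation context that is well typed in the store typing `S`. -/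
def Frame.Typed (S : ℕ → Option Ty) (F : Frame O) : Prop :=
  F.ctx.Valid ∧ ∃ T', ∀ e, HasTy S [] [] e F.holeTy → HasTy S [] [] (F.ctx.fill e) T'

theorem Frame.Typed.mono {S S' : ℕ → Option Ty} (hS : TyLe S S') {F : Frame O} (h : F.Typed S) :
    F.Typed S' :=
  h.imp_right (Exists.imp fun _ => ECtx.hasTy_fill_mono hS)

theorem Frame.Typed.ren_eq_self {S : ℕ → Option Ty} {ρ : ℕ → ℕ}
    (hρ : ∀ l T, S l = some T → ρ l = l) {F : Frame O} (h : F.Typed S) : F.ren ρ = F := by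
  obtain ⟨-, T', hF⟩ := h
  obtain ⟨e, he⟩ := exists_hasTy_iff_eq (O := O) F.holeTy
  rw [Frame.ren, F.ctx.ren_eq_self ((hF e ((he ..).2 rfl)).ren_eq_self hρ)]

/-- All components of a configuration are well typed in the store typing `S`. -/
structure WellTyped (S : ℕ → Option Ty) (Γ : Env O) (K : List (Frame O)) (s : Store O)
    (e : Option (Exp O)) : Prop where
  store : StoreTyping s S
  env : AllValues (TypedVal S) Γ
  stack : ∀ F ∈ K, F.Typed S
  exp : ∀ e₀, e = some e₀ → ∃ T, HasTy S [] [] e₀ T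

/-- All abstract names of the components of a configuration are in `A`. -/
structure NamesIn (A : Set Name) (Γ : Env O) (K : List (Frame O)) (s : Store O)
    (e : Option (Exp O)) : Prop where
  env : AllValues (Exp.names · ⊆ A) Γ
  stack : ∀ F ∈ K, F.ctx.names ⊆ A
  store : AllValues (Exp.names · ⊆ A) s
  exp : ∀ e₀, e = some e₀ → e₀.names ⊆ A

section WellFormed

variable {A A' : Set Name} {Γ Γ' : Env O} {K K' : List (Frame O)} {s s' : Store O}
  {e e' : Option (Exp O)} {S : ℕ → Option Ty} {η : Label O}

theorem wellFormed_iff :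
    WellFormed A Γ K s e ↔ A.Finite ∧ NamesIn A Γ K s e ∧ ∃ S, WellTyped S Γ K s e :=
  ⟨fun ⟨hA, h₁, h₂, h₃, h₄, S, h₅, h₆, h₇, h₈⟩ =>
      ⟨hA, ⟨h₁, h₂, h₃, h₄⟩, S, ⟨h₅, h₆, h₇, h₈⟩⟩,
    fun ⟨hA, ⟨h₁, h₂, h₃, h₄⟩, S, ⟨h₅, h₆, h₇, h₈⟩⟩ =>
      ⟨hA, h₁, h₂, h₃, h₄, S, h₅, h₆, h₇, h₈⟩⟩

theorem NamesIn.mono (h : NamesIn A Γ K s e) (hA : A ⊆ A') : NamesIn A' Γ K s e where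
  env := h.env.imp fun _ h => h.trans hA
  stack F hF := (h.stack F hF).trans hA
  store := h.store.imp fun _ h => h.trans hA
  exp e₀ he := (h.exp e₀ he).trans hA

theorem NamesIn.trans (h : NamesIn A Γ K s e)
    (ht : Trans (.mk A Γ K s e) η (.mk A' Γ' K' s' e')) : NamesIn A' Γ' K' s' e' := by
  cases ht with
  | propApp _ _ Γ' _ _ E a v D hE hv hD =>
    obtain ⟨hE, hav⟩ := (E.names_fill_subset_iff _).1 (h.exp _ rfl)
    have hvA : v.names ⊆ A := (Set.union_subset_iff.1 hav).2
    exact ⟨h.env.union (hD.names hvA), List.forall_mem_cons.2 ⟨hE, h.stack⟩, h.store, by simp⟩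
  | propRet _ _ Γ' _ _ v D hv hD =>
    exact ⟨h.env.union (hD.names (h.exp _ rfl)), h.stack, h.store, by simp⟩
  | opApp _ _ _ _ _ i v u e _ _ hi _ _ _ _ he =>
    have hle := h.mono (Set.subset_union_left (t := u.names))
    exact ⟨hle.env, hle.stack, hle.store, by
      rintro _ ⟨⟩
      exact he.names (hle.env i v hi) Set.subset_union_right⟩
  | opRet _ _ _ _ T E u =>
    have hle := h.mono (Set.subset_union_left (t := u.names))
    obtain ⟨hE, hK⟩ := List.forall_mem_cons.1 hle.stack
    exact ⟨hle.env, hK, hle.store, by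
      rintro _ ⟨⟩
      exact (E.names_fill_subset_iff _).2 ⟨hE, Set.subset_union_right⟩⟩
  | tau _ _ _ _ _ e e' hred =>
    obtain ⟨hs, he⟩ := hred.names h.store (h.exp _ rfl)
    exact ⟨h.env, h.stack, hs, by rintro _ ⟨⟩; exact he⟩

theorem WellTyped.trans (h : WellTyped S Γ K s e)
    (ht : Trans (.mk A Γ K s e) η (.mk A' Γ' K' s' e')) : ∃ S', WellTyped S' Γ' K' s' e' := by
  cases ht with
  | propApp _ _ Γ' _ _ E a v D hE hv hD =>
    obtain ⟨T, hT⟩ := h.exp _ rfl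
    obtain ⟨U, hU, hfill⟩ := E.hasTy_fill hT
    cases hU with | app _ _ T₁ _ ha hvT =>
    cases ha
    have hF : Frame.Typed S ⟨a.cod, E⟩ := ⟨hE, T, fun e => hfill S e (.refl S)⟩
    exact ⟨S, h.store, h.env.union (hD.typedVal hvT), List.forall_mem_cons.2 ⟨hF, h.stack⟩, by simp⟩
  | propRet _ _ Γ' _ _ v D hv hD =>
    obtain ⟨T, hT⟩ := h.exp _ rfl
    exact ⟨S, h.store, h.env.union (hD.typedVal hT), h.stack, by simp⟩
  | opApp _ _ _ _ _ i v u e T T' hi _ hT hu _ he =>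
    refine ⟨S, h.store, h.env, h.stack, ?_⟩
    rintro _ ⟨⟩
    obtain ⟨-, U, hU⟩ := h.env i v hi
    exact ⟨T', he.hasTy (he.hasTy_arr hT hU) (hu.hasTy S) hu.isVal⟩
  | opRet _ _ _ _ T E u hu =>
    obtain ⟨⟨-, U, hU⟩, hK⟩ := List.forall_mem_cons.1 h.stack
    refine ⟨S, h.store, h.env, hK, ?_⟩
    rintro _ ⟨⟩
    exact ⟨U, hU u (hu.hasTy S)⟩
  | tau _ _ _ _ _ e e' hred =>
    obtain ⟨T, hT⟩ := h.exp _ rfl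
    obtain ⟨S', hle, hs', he'⟩ := hred.preserves h.store hT
    refine ⟨S', hs', h.env.imp fun _ => TypedVal.mono hle, fun F hF => (h.stack F hF).mono hle, ?_⟩
    rintro _ ⟨⟩
    exact ⟨T, he'⟩

theorem WellFormed.trans (h : WellFormed A Γ K s e)
    (ht : Trans (.mk A Γ K s e) η (.mk A' Γ' K' s' e')) : WellFormed A' Γ' K' s' e' := by
  obtain ⟨hA, hn, S, hS⟩ := wellFormed_iff.1 h
  have hA' : A' = A ∪ η.names := ht.used (by simp)
  exact wellFormed_iff.2 ⟨hA' ▸ hA.union η.finite_names, hn.trans ht, hS.trans ht⟩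

theorem WellTyped.ren_eq_self {ρ : ℕ ↪ ℕ} (h : WellTyped S Γ K s e) (hρ : ∀ l ∈ s, ρ l = l) :
    Conf.ren ρ (.mk A Γ K s e) = .mk A Γ K s e := by
  have hρS : ∀ l T, S l = some T → ρ l = l := fun l T hl => hρ l ((h.store.dom l).1 ⟨T, hl⟩)
  have hΓ : Env.ren ρ Γ = Γ := mapFinmap_eq_self fun i v hi =>
    ⟨rfl, (h.env i v hi).2.elim fun _ hT => hT.ren_eq_self hρS⟩
  have hs : Store.ren ρ s = s := mapFinmap_eq_self fun l v hl => by
    obtain ⟨T, hT⟩ := (h.store.dom l).2 (Finmap.mem_of_lookup_eq_some hl)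
    exact ⟨hρS l T hT, (h.store.typed l v T hl hT).2.ren_eq_self hρS⟩
  have hK : K.map (Frame.ren ρ) = K :=
    (List.map_congr_left fun F hF => (h.stack F hF).ren_eq_self hρS).trans K.map_id
  have he : e.map (Exp.ren ρ) = e := by
    cases e with
    | none => rfl
    | some e =>
      obtain ⟨T, hT⟩ := h.exp e rfl
      rw [Option.map_some, hT.ren_eq_self hρS]
  rw [Conf.ren, hΓ, hs, hK, he]

end WellFormed

/-! ### Separating conjunctions -/

/-- The other component. -/
def Side.swap : Side → Side
  | .one => .two
  | .two => .one

theorem Interleave.swap {k : List Side} {K₁ K₂ K : List (Frame O)} (h : Interleave k K₁ K₂ K) :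
    Interleave (k.map Side.swap) K₂ K₁ K := by
  induction h with
  | nil => exact .nil
  | one k E K₁ K₂ K _ ih => exact .two _ _ _ _ _ ih
  | two k E K₁ K₂ K _ ih => exact .one _ _ _ _ _ ih

section SepConj

variable {i : Side} {k k' : List Side} {C₁ C₁' C₂ C D : Conf O} {η : Label O}

theorem SepConj.swap (h : SepConj i k C₁ C₂ C) : SepConj i.swap (k.map Side.swap) C₂ C₁ C := by
  cases h with
  | one _ A₁ A₂ Γ₁ Γ₂ K₁ K₂ K s₁ s₂ e h₁ h₂ hΓ hK hs =>
    rw [Set.union_comm, Finmap.union_comm_of_disjoint hΓ, Finmap.union_comm_of_disjoint hs]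
    exact .two _ _ _ _ _ _ _ _ _ _ _ h₂ h₁ hΓ.symm hK.swap hs.symm
  | two _ A₁ A₂ Γ₁ Γ₂ K₁ K₂ K s₁ s₂ e h₁ h₂ hΓ hK hs =>
    rw [Set.union_comm, Finmap.union_comm_of_disjoint hΓ, Finmap.union_comm_of_disjoint hs]
    exact .one _ _ _ _ _ _ _ _ _ _ _ h₂ h₁ hΓ.symm hK.swap hs.symm

theorem SepConj.two_of_isOpp (h : SepConj .one k C₁ C₂ C) (hC₁ : C₁.IsOpp) :
    SepConj .two k C₁ C₂ C := by
  cases h with | one _ _ _ _ _ _ _ _ _ _ e h₁ h₂ hΓ hK hs =>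
  cases e with
  | some e => exact hC₁.elim
  | none => exact .two _ _ _ _ _ _ _ _ _ _ _ h₁ h₂ hΓ hK hs

theorem SepConj.swap_of_isOpp (h : SepConj .one k C₁ C₂ C) (hC₁ : C₁.IsOpp) :
    SepConj .one (k.map Side.swap) C₂ C₁ C :=
  (h.two_of_isOpp hC₁).swap

theorem SepConj.envDom_disjoint (h : SepConj i k C₁ C₂ C) : Disjoint C₁.envDom C₂.envDom := by
  cases h <;> exact disjoint_iff_disjoint_keys.1 ‹_›

theorem SepConj.storeDom_disjoint (h : SepConj i k C₁ C₂ C) :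
    Disjoint C₁.storeDom C₂.storeDom := by
  cases h <;> exact disjoint_iff_disjoint_keys.1 ‹_›

theorem SepConj.left_ne_bot (h : SepConj i k C₁ C₂ C) : C₁ ≠ .bot := by
  cases h <;> simp

section Components

variable {A₁ A₂ N : Set Name} {Γ₁ Γ₂ Γ' : Env O} {K₁ K₂ K : List (Frame O)} {s₁ s₂ : Store O}
  {e : Option (Exp O)}

theorem sepConj_one_union_names (h₁ : WellFormed (A₁ ∪ N) Γ₁ K₁ s₁ e)
    (h₂ : WellFormed A₂ Γ₂ K₂ s₂ none) (hΓ : Γ₁.Disjoint Γ₂) (hK : Interleave k K₁ K₂ K)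
    (hs : s₁.Disjoint s₂) :
    SepConj .one k (.mk (A₁ ∪ N) Γ₁ K₁ s₁ e) (.mk A₂ Γ₂ K₂ s₂ none)
      (.mk (A₁ ∪ A₂ ∪ N) (Γ₁ ∪ Γ₂) K (s₁ ∪ s₂) e) := by
  rw [Set.union_right_comm]
  exact .one _ _ _ _ _ _ _ _ _ _ _ h₁ h₂ hΓ hK hs

theorem sepConj_one_union_env (h₁ : WellFormed A₁ (Γ₁ ∪ Γ') K₁ s₁ e)
    (h₂ : WellFormed A₂ Γ₂ K₂ s₂ none) (hΓ : Γ₁.Disjoint Γ₂) (hΓ' : Γ'.Disjoint Γ₂)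
    (hK : Interleave k K₁ K₂ K) (hs : s₁.Disjoint s₂) :
    SepConj .one k (.mk A₁ (Γ₁ ∪ Γ') K₁ s₁ e) (.mk A₂ Γ₂ K₂ s₂ none)
      (.mk (A₁ ∪ A₂) (Γ₁ ∪ Γ₂ ∪ Γ') K (s₁ ∪ s₂) e) := by
  rw [← union_right_comm_of_disjoint hΓ']
  exact .one _ _ _ _ _ _ _ _ _ _ _ h₁ h₂ ((Finmap.disjoint_union_left _ _ _).2 ⟨hΓ, hΓ'⟩) hK hs

end Components

/-- The effect of a transition of the first component on the sequence that interleaves the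
stacks. -/
def StackStep : Label O → List Side → List Side → Prop
  | .papp _ _, k, k' => k' = .one :: k
  | .oret _, k, k' => k = .one :: k'
  | _, k, k' => k' = k

section StoreTyping

variable {s₁ s₂ : Store O} {S₁ S₂ : ℕ → Option Ty}

theorem tyLe_or_left (S₁ S₂ : ℕ → Option Ty) : TyLe S₁ fun l => (S₁ l).or (S₂ l) :=
  fun _ _ h => Option.or_eq_some_iff.2 (.inl h)

theorem StoreTyping.tyLe_or_right (h₁ : StoreTyping s₁ S₁) (h₂ : StoreTyping s₂ S₂)
    (hd : s₁.Disjoint s₂) : TyLe S₂ fun l => (S₁ l).or (S₂ l) := fun l T h => by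
  have hl : S₁ l = none := by
    by_contra hne
    exact hd l ((h₁.dom l).1 (Option.ne_none_iff_exists'.1 hne)) ((h₂.dom l).1 ⟨T, h⟩)
  simpa only [hl, Option.none_or] using h

theorem StoreTyping.typed_of_tyLe {S : ℕ → Option Ty} (h : StoreTyping s₁ S₁) (hS : TyLe S₁ S)
    {l : ℕ} {v : Exp O} {T : Ty} (hv : s₁.lookup l = some v) (hT : S l = some T) :
    IsVal v ∧ HasTy S [] [] v T := by
  obtain ⟨T', hT'⟩ := (h.dom l).2 (Finmap.mem_of_lookup_eq_some hv)
  cases (hS l T' hT').symm.trans hT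
  exact (h.typed l v T hv hT').imp_right (HasTy.mono hS)

theorem StoreTyping.union (h₁ : StoreTyping s₁ S₁) (h₂ : StoreTyping s₂ S₂)
    (hd : s₁.Disjoint s₂) : StoreTyping (s₁ ∪ s₂) fun l => (S₁ l).or (S₂ l) where
  dom l := by
    rw [Finmap.mem_union, ← h₁.dom, ← h₂.dom]
    cases S₁ l <;> simp
  typed l v T hv hT := by
    rcases Finmap.mem_lookup_union.1 hv with hv | ⟨-, hv⟩
    · exact h₁.typed_of_tyLe (tyLe_or_left S₁ S₂) hv hT
    · exact h₂.typed_of_tyLe (h₁.tyLe_or_right h₂ hd) hv hT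

end StoreTyping

theorem SepConj.trans_left (hC : SepConj .one k C₁ C₂ C) (h : Trans C₁ η C₁') (hC₁' : C₁' ≠ .bot)
    (hk : StackStep η k k') (hh : Disjoint η.holes C₂.envDom) (hn : Disjoint η.names C₂.used)
    (hs' : Disjoint C₁'.storeDom C₂.storeDom) :
    ∃ C', Trans C η C' ∧ SepConj .one k' C₁' C₂ C' := by
  cases hC with | one _ A₁ A₂ Γ₁ Γ₂ K₁ K₂ K s₁ s₂ e h₁ h₂ hΓ hK hs =>
  cases C₁' with
  | bot => exact absurd rfl hC₁'
  | mk A' Γ' K' s' e' =>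
  have hwf := h₁.trans h
  cases h with
  | propApp _ _ Γ' _ _ E a v D hE hv hD hΓ' =>
    obtain rfl : k' = .one :: k := hk
    have hd : Γ'.Disjoint Γ₂ := disjoint_iff_disjoint_keys.2 (hD.keys ▸ hh)
    exact ⟨_, .propApp _ _ Γ' _ _ E a v D hE hv hD
      ((Finmap.disjoint_union_left _ _ _).2 ⟨hΓ', hd.symm⟩),
      sepConj_one_union_env hwf h₂ hΓ hd (.one _ _ _ _ _ hK) hs⟩
  | propRet _ _ Γ' _ _ v D hv hD hΓ' =>
    obtain rfl : k' = k := hk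
    have hd : Γ'.Disjoint Γ₂ := disjoint_iff_disjoint_keys.2 (hD.keys ▸ hh)
    exact ⟨_, .propRet _ _ Γ' _ _ v D hv hD
      ((Finmap.disjoint_union_left _ _ _).2 ⟨hΓ', hd.symm⟩),
      sepConj_one_union_env hwf h₂ hΓ hd hK hs⟩
  | opApp _ _ _ _ S i v u e T T' hi hS hT hu hA he =>
    obtain rfl : k' = k := hk
    obtain ⟨-, -, S₂, hS₂⟩ := wellFormed_iff.1 h₂
    exact ⟨_, .opApp _ _ _ _ _ i v u e T T'
      ((Finmap.lookup_union_left (Finmap.mem_of_lookup_eq_some hi)).trans hi)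
      (hS.union hS₂.store hs) (hT.mono (tyLe_or_left S S₂)) hu
      (Set.disjoint_union_left.2 ⟨hA, hn.symm⟩) he, sepConj_one_union_names hwf h₂ hΓ hK hs⟩
  | opRet _ _ _ _ T E u hu hA =>
    obtain rfl : k = .one :: k' := hk
    cases hK with | one _ _ _ _ _ hK =>
    exact ⟨_, .opRet _ _ _ _ T E u hu (Set.disjoint_union_left.2 ⟨hA, hn.symm⟩),
      sepConj_one_union_names hwf h₂ hΓ hK hs⟩
  | tau _ _ _ _ _ e e' h =>
    obtain rfl : k' = k := hk
    have hd : s'.Disjoint s₂ := disjoint_iff_disjoint_keys.2 hs'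
    exact ⟨_, .tau _ _ _ _ _ _ _ (h.frame hd), .one _ _ _ _ _ _ _ _ _ _ _ hwf h₂ hΓ hK hd⟩

/-- `D` is reached by a transition of the first component of the conjunction of `C₁` and `C₂`
along `k`, a transition that introduces no abstract name of `C₂`. -/
inductive LeftMove (k : List Side) (C₁ C₂ : Conf O) (η : Label O) (D : Conf O) : Prop
  | intro (k' : List Side) (C₁' : Conf O) (trans : Trans C₁ η C₁') (stack : StackStep η k k')
      (conj : SepConj .one k' C₁' C₂ D) (names : Disjoint η.names C₂.used) : LeftMove k C₁ C₂ η D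

section LeftMove

variable {A A₁ A₂ : Set Name} {Γ Γ₁ Γ₂ Γ' : Env O} {K K₁ K₂ : List (Frame O)} {s s₁ s₂ s' : Store O}
  {e e' u v : Exp O} {E : ECtx O} {T T' : Ty} {Dp : Pat}

theorem leftMove_papp {a : Name}
    (h₁ : WellFormed A₁ Γ₁ K₁ s₁ (some (E.fill (.app (.name a) v))))
    (h₂ : WellFormed A₂ Γ₂ K₂ s₂ none) (hΓ : Γ₁.Disjoint Γ₂) (hK : Interleave k K₁ K₂ K)
    (hs : s₁.Disjoint s₂) (hE : E.Valid) (hv : IsVal v) (hD : UltPat v Dp Γ')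
    (hΓ' : (Γ₁ ∪ Γ₂).Disjoint Γ') :
    LeftMove k (.mk A₁ Γ₁ K₁ s₁ (some (E.fill (.app (.name a) v)))) (.mk A₂ Γ₂ K₂ s₂ none)
      (.papp a Dp) (.mk (A₁ ∪ A₂) (Γ₁ ∪ Γ₂ ∪ Γ') (⟨a.cod, E⟩ :: K) (s₁ ∪ s₂) none) := by
  obtain ⟨hd₁, hd₂⟩ := (Finmap.disjoint_union_left _ _ _).1 hΓ'
  have ht := Trans.propApp A₁ Γ₁ Γ' K₁ s₁ E a v Dp hE hv hD hd₁
  exact ⟨.one :: k, _, ht, rfl,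
    sepConj_one_union_env (h₁.trans ht) h₂ hΓ hd₂.symm (.one _ _ _ _ _ hK) hs,
    Set.empty_disjoint _⟩

theorem leftMove_pret (h₁ : WellFormed A₁ Γ₁ K₁ s₁ (some v))
    (h₂ : WellFormed A₂ Γ₂ K₂ s₂ none) (hΓ : Γ₁.Disjoint Γ₂) (hK : Interleave k K₁ K₂ K)
    (hs : s₁.Disjoint s₂) (hv : IsVal v) (hD : UltPat v Dp Γ') (hΓ' : (Γ₁ ∪ Γ₂).Disjoint Γ') :
    LeftMove k (.mk A₁ Γ₁ K₁ s₁ (some v)) (.mk A₂ Γ₂ K₂ s₂ none) (.pret Dp)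
      (.mk (A₁ ∪ A₂) (Γ₁ ∪ Γ₂ ∪ Γ') K (s₁ ∪ s₂) none) := by
  obtain ⟨hd₁, hd₂⟩ := (Finmap.disjoint_union_left _ _ _).1 hΓ'
  have ht := Trans.propRet A₁ Γ₁ Γ' K₁ s₁ v Dp hv hD hd₁
  exact ⟨k, _, ht, rfl, sepConj_one_union_env (h₁.trans ht) h₂ hΓ hd₂.symm hK hs,
    Set.empty_disjoint _⟩

theorem leftMove_tau (h₁ : WellFormed A₁ Γ₁ K₁ s₁ (some e)) (h₂ : WellFormed A₂ Γ₂ K₂ s₂ none)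
    (hΓ : Γ₁.Disjoint Γ₂) (hK : Interleave k K₁ K₂ K) (hs : s₁.Disjoint s₂)
    (h : Red (s₁ ∪ s₂) e s' e') :
    LeftMove k (.mk A₁ Γ₁ K₁ s₁ (some e)) (.mk A₂ Γ₂ K₂ s₂ none) .tau
      (.mk (A₁ ∪ A₂) (Γ₁ ∪ Γ₂) K s' (some e')) := by
  obtain ⟨-, -, S, hS⟩ := wellFormed_iff.1 h₁
  obtain ⟨T, hT⟩ := hS.exp _ rfl
  obtain ⟨s₁', hred, rfl, hs'⟩ := h.unframe hs hS.store hT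
  have ht := Trans.tau A₁ Γ₁ K₁ s₁ s₁' e e' hred
  exact ⟨k, _, ht, rfl, .one _ _ _ _ _ _ _ _ _ _ _ (h₁.trans ht) h₂ hΓ hK hs',
    Set.empty_disjoint _⟩

theorem leftMove_oapp {S : ℕ → Option Ty} {i : ℕ}
    (hC : SepConj .one k (.mk A₁ Γ₁ K₁ s₁ none) (.mk A₂ Γ₂ K₂ s₂ none) (.mk A Γ K s none))
    (hi : Γ₁.lookup i = some v) (hT : HasTy S [] [] v (.arr T T')) (hu : OppVal T u)
    (hA : Disjoint A u.names) (he : FunRed v u e) :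
    LeftMove k (.mk A₁ Γ₁ K₁ s₁ none) (.mk A₂ Γ₂ K₂ s₂ none) (.oapp i u)
      (.mk (A ∪ u.names) Γ K s (some e)) := by
  cases hC with | one _ _ _ _ _ _ _ _ _ _ _ h₁ h₂ hΓ hK hs =>
  obtain ⟨hA₁, hA₂⟩ := Set.disjoint_union_left.1 hA
  obtain ⟨-, -, S₁, hS₁⟩ := wellFormed_iff.1 h₁
  obtain ⟨-, U, hU⟩ := hS₁.env i v hi
  have ht := Trans.opApp A₁ Γ₁ K₁ s₁ S₁ i v u e T T' hi hS₁.store (he.hasTy_arr hT hU) hu hA₁ he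
  exact ⟨k, _, ht, rfl, sepConj_one_union_names (h₁.trans ht) h₂ hΓ hK hs, hA₂.symm⟩

theorem leftMove_oret
    (hC : SepConj .one (.one :: k) (.mk A₁ Γ₁ (⟨T, E⟩ :: K₁) s₁ none) (.mk A₂ Γ₂ K₂ s₂ none)
      (.mk A Γ (⟨T, E⟩ :: K) s none))
    (hu : OppVal T u) (hA : Disjoint A u.names) :
    LeftMove (.one :: k) (.mk A₁ Γ₁ (⟨T, E⟩ :: K₁) s₁ none) (.mk A₂ Γ₂ K₂ s₂ none) (.oret u)
      (.mk (A ∪ u.names) Γ K s (some (E.fill u))) := by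
  cases hC with | one _ _ _ _ _ _ _ _ _ _ _ h₁ h₂ hΓ hK hs =>
  cases hK with | one _ _ _ _ _ hK =>
  obtain ⟨hA₁, hA₂⟩ := Set.disjoint_union_left.1 hA
  have ht := Trans.opRet A₁ Γ₁ K₁ s₁ T E u hu hA₁
  exact ⟨k, _, ht, rfl, sepConj_one_union_names (h₁.trans ht) h₂ hΓ hK hs, hA₂.symm⟩

end LeftMove

theorem SepConj.trans_cases (hC : SepConj .one k C₁ C₂ C) (h : Trans C η D) :
    (D = .bot ∧ η ≠ .term) ∨
    (D = .bot ∧ η = .term ∧ k = [] ∧ Trans C₁ .term .bot ∧ Trans C₂ .term .bot) ∨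
    LeftMove k C₁ C₂ η D ∨ (C₁.IsOpp ∧ LeftMove (k.map Side.swap) C₂ C₁ η D) := by
  have hconj := hC
  cases hC with | one _ A₁ A₂ Γ₁ Γ₂ K₁ K₂ K s₁ s₂ e h₁ h₂ hΓ hK hs =>
  cases h with
  | propApp _ _ Γ' _ _ E a v D hE hv hD hΓ' =>
    exact .inr (.inr (.inl (leftMove_papp h₁ h₂ hΓ hK hs hE hv hD hΓ')))
  | propRet _ _ Γ' _ _ v D hv hD hΓ' =>
    exact .inr (.inr (.inl (leftMove_pret h₁ h₂ hΓ hK hs hv hD hΓ')))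
  | opApp _ _ _ _ S i v u e T T' hi hS hT hu hA he =>
    rcases Finmap.mem_lookup_union.1 hi with hi | ⟨-, hi⟩
    · exact .inr (.inr (.inl (leftMove_oapp hconj hi hT hu hA he)))
    · exact .inr (.inr (.inr ⟨trivial,
        leftMove_oapp (hconj.swap_of_isOpp trivial) hi hT hu hA he⟩))
  | opRet _ _ K' _ T E u hu hA =>
    cases hK with
    | one => exact .inr (.inr (.inl (leftMove_oret hconj hu hA)))
    | two => exact .inr (.inr (.inr ⟨trivial, leftMove_oret (hconj.swap_of_isOpp trivial) hu hA⟩))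
  | tau _ _ _ _ s' e e' h => exact .inr (.inr (.inl (leftMove_tau h₁ h₂ hΓ hK hs h)))
  | response _ _ h => exact .inl ⟨rfl, h⟩
  | term _ _ _ =>
    cases hK
    exact .inr (.inl ⟨rfl, rfl, rfl, .term _ _ _, .term _ _ _⟩)

theorem SepConj.term (hC : SepConj .one [] C₁ C₂ C) (hC₁ : C₁.IsOpp) : Trans C .term .bot := by
  cases hC with | one _ _ _ _ _ _ _ _ _ _ e h₁ h₂ hΓ hK hs =>
  cases hK
  cases e with
  | none => exact .term _ _ _
  | some e => exact hC₁.elim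

theorem SepConj.tauStar_left (hC : SepConj .one k C₁ C₂ C) (h : TauStar C₁ C₁')
    (hC₁' : C₁' ≠ .bot) (hs : Disjoint C₁'.storeDom C₂.storeDom) :
    ∃ C', TauStar C C' ∧ SepConj .one k C₁' C₂ C' := by
  induction h using Relation.ReflTransGen.head_induction_on generalizing C with
  | refl => exact ⟨C, .refl, hC⟩
  | head h h' ih =>
    obtain ⟨C', ht, hC'⟩ := hC.trans_left h (TauStar.ne_bot h' hC₁') (k' := k) rfl
      (Finset.disjoint_empty_left _) (Set.empty_disjoint _)
      (hs.mono_left (TauStar.storeDom_subset h' hC₁'))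
    obtain ⟨C'', ht', hC''⟩ := ih hC'
    exact ⟨C'', .head ht ht', hC''⟩

theorem SepConj.wTrans_left (hC : SepConj .one k C₁ C₂ C) (h : WTrans C₁ η C₁') (hC₁' : C₁' ≠ .bot)
    (hk : StackStep η k k') (hh : Disjoint η.holes C₂.envDom) (hn : Disjoint η.names C₂.used)
    (hs : Disjoint C₁'.storeDom C₂.storeDom) :
    ∃ C', WTrans C η C' ∧ SepConj .one k' C₁' C₂ C' := by
  obtain ⟨rfl, h⟩ | ⟨hη, D₁, D₂, h₁, h₂, h₃⟩ := h
  · obtain rfl : k' = k := hk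
    obtain ⟨C', h', hC'⟩ := hC.tauStar_left h hC₁' hs
    exact ⟨C', .inl ⟨rfl, h'⟩, hC'⟩
  · have hD₂ := h₃.ne_bot hC₁'
    have hs₂ := hs.mono_left (h₃.storeDom_subset hC₁')
    have hs₁ := hs₂.mono_left (h₂.storeDom_subset hD₂)
    obtain ⟨E₁, t₁, hE₁⟩ := hC.tauStar_left h₁ (h₂.ne_bot hD₂) hs₁
    obtain ⟨E₂, t₂, hE₂⟩ := hE₁.trans_left h₂ hD₂ hk hh hn hs₂
    obtain ⟨C', t₃, hC'⟩ := hE₂.tauStar_left h₃ hC₁' hs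
    exact ⟨C', .inr ⟨hη, E₁, E₂, t₁, t₂, t₃⟩, hC'⟩

theorem exists_embedding_fixing_avoiding (s s' : Finset ℕ) :
    ∃ ρ : ℕ ↪ ℕ, (∀ l ∈ s, ρ l = l) ∧ ∀ l ∉ s, ρ l ∉ s' := by
  obtain ⟨N, hN⟩ := (s ∪ s').exists_nat_subset_range
  have hlt : ∀ l, l ∈ s ∨ l ∈ s' → l < N := fun l hl => by
    simpa using hN (Finset.mem_union.2 hl)
  have hinj : Function.Injective fun l => if l ∈ s then l else l + N := by
    intro l l' h
    have := hlt l
    have := hlt l'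
    grind
  refine ⟨⟨_, hinj⟩, fun l hl => if_pos hl, fun l hl h => ?_⟩
  have := hlt _ (.inr h)
  simp [hl] at this

theorem Conf.ren_ne_bot (ρ : ℕ ↪ ℕ) (hC : C ≠ .bot) : C.ren ρ ≠ .bot := by
  cases C with
  | bot => exact absurd rfl hC
  | mk => simp [Conf.ren]

theorem Conf.envDom_ren (ρ : ℕ ↪ ℕ) (C : Conf O) : (C.ren ρ).envDom = C.envDom := by
  cases C with
  | bot => rfl
  | mk => ext i; simp [Conf.ren, Conf.envDom, Finmap.mem_keys, Env.mem_ren]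

theorem Conf.used_ren (ρ : ℕ ↪ ℕ) (C : Conf O) : (C.ren ρ).used = C.used := by
  cases C <;> rfl

theorem Conf.mem_storeDom_ren {ρ : ℕ ↪ ℕ} {l : ℕ} :
    l ∈ (C.ren ρ).storeDom ↔ ∃ l' ∈ C.storeDom, ρ l' = l := by
  cases C with
  | bot => simp [Conf.ren, Conf.storeDom]
  | mk => simp [Conf.ren, Conf.storeDom, Finmap.mem_keys, Store.ren, mem_mapFinmap]

theorem SepConj.left_ren_eq_self (hC : SepConj .one k C₁ C₂ C) {ρ : ℕ ↪ ℕ}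
    (hρ : ∀ l ∈ C₁.storeDom, ρ l = l) : C₁.ren ρ = C₁ := by
  cases hC with | one _ _ _ _ _ _ _ _ _ _ _ h₁ =>
  obtain ⟨-, -, S, hS⟩ := wellFormed_iff.1 h₁
  exact hS.ren_eq_self fun l hl => hρ l (Finmap.mem_keys.2 hl)

theorem SepConj.exists_wTrans_left_ren (hC : SepConj .one k C₁ C₂ C) (h : WTrans C₁ η C₁')
    (hC₁' : C₁' ≠ .bot) (hk : StackStep η k k') (hh : Disjoint η.holes C₂.envDom)
    (hn : Disjoint η.names C₂.used) :
    ∃ ρ C', WTrans C η C' ∧ SepConj .one k' (C₁'.ren ρ) C₂ C' := by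
  obtain ⟨ρ, hfix, havoid⟩ := exists_embedding_fixing_avoiding C₁.storeDom C₂.storeDom
  have hw : WTrans C₁ η (C₁'.ren ρ) := hC.left_ren_eq_self hfix ▸ h.ren ρ
  have hs : Disjoint (C₁'.ren ρ).storeDom C₂.storeDom := by
    refine Finset.disjoint_left.2 fun l hl => ?_
    obtain ⟨l', -, rfl⟩ := Conf.mem_storeDom_ren.1 hl
    by_cases hl' : l' ∈ C₁.storeDom
    · rw [hfix l' hl']
      exact Finset.disjoint_left.1 hC.storeDom_disjoint hl'
    · exact havoid l' hl'
  exact ⟨ρ, hC.wTrans_left hw (Conf.ren_ne_bot ρ hC₁') hk hh hn hs⟩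

end SepConj

/-! ### Up to separation -/

theorem utSep_mono : Monotone (utSep (O := O)) := by
  intro R R' hR C C' h
  cases h with
  | sep i k C₁ C₂ C₃ C₄ _ _ h₁ h₂ hd₁ hd₂ hA₁ hA₂ hC hC' =>
    exact .sep i k C₁ C₂ C₃ C₄ _ _ (hR _ _ h₁) (hR _ _ h₂) hd₁ hd₂ hA₁ hA₂ hC hC'
  | botL i k C₁ C₃ C₄ _ h₁ h₂ hC => exact .botL i k C₁ C₃ C₄ _ (hR _ _ h₁) (hR _ _ h₂) hC
  | botR i k C₁ C₂ C₃ _ h₁ h₂ hC => exact .botR i k C₁ C₂ C₃ _ (hR _ _ h₁) (hR _ _ h₂) hC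

section

variable {x : CRel O} {i : Side} {k : List Side} {C₁ C₂ C₃ C₄ C C' D : Conf O} {η : Label O}

theorem Tower.refl (hx : Tower WP x) (C : Conf O) : x C C := by
  refine hx.le_of_compatible (f := fun _ => Eq) WP_mono (fun _ _ _ => le_rfl) ?_ C C rfl
  rintro _ C _ rfl η C' ht
  exact ⟨C', ht.weak, rfl⟩

theorem Tower.ren (hx : Tower WP x) (h : x C C') (ρ : ℕ ↪ ℕ) : x C (C'.ren ρ) := by
  refine hx.le_of_compatible (f := fun R C₁ C₂ => ∃ C, R C₁ C ∧ C₂ = C.ren ρ) WP_mono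
    (fun R R' hR C₁ C₂ ⟨C, hC, he⟩ => ⟨C, hR _ _ hC, he⟩) ?_ _ _ ⟨C', h, rfl⟩
  rintro R C₁ _ ⟨C, hC, rfl⟩ η C₁' ht
  obtain ⟨C', hw, hR⟩ := hC η C₁' ht
  exact ⟨C'.ren ρ, hw.ren ρ, C', hR, rfl⟩

theorem WP_of_bot (h : WP x C .bot) (C' : Conf O) : WP x C C' := by
  intro η D ht
  obtain ⟨D', hw, hD⟩ := h η D ht
  obtain ⟨rfl, hη⟩ := hw.of_bot
  exact ⟨.bot, .response C' hη, hD⟩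

theorem WP_bot_of_isOpp (hx : Tower WP x) (h : WP x C C') (hC : C.IsOpp) (hC' : ¬ C'.IsOpp) :
    WP x C .bot := by
  intro η D ht
  rcases ht.label_isOpp hC with ⟨rfl, hη⟩ | hη
  · exact ⟨.bot, .response _ hη, hx.refl _⟩
  · obtain ⟨D', hw, hD⟩ := h η D ht
    have hresponse : ¬(D' ≠ .bot ∨ η = .term) := fun hD' => hC' (hw.isOpp_of_label hη hD')
    rw [not_or, not_not] at hresponse
    obtain ⟨rfl, hη'⟩ := hresponse
    exact ⟨.bot, .response _ hη', hD⟩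

theorem utSep_bot (hC : SepConj i k C₁ C₃ C) (h₁ : x C₁ C₂) (h₂ : x C₃ C₄)
    (hbot : C₂ = .bot ∨ C₄ = .bot) : utSep x C .bot := by
  rcases hbot with rfl | rfl
  · exact .botL i k C₁ C₃ C₄ C h₁ h₂ hC
  · exact .botR i k C₁ C₂ C₃ C h₁ h₂ hC

theorem LeftMove.bot (hm : LeftMove k C₁ C₃ η D) (hsep : utSep x ≤ x) (h₁ : WP x C₁ C₂)
    (h₂ : x C₃ C₄) (hbot : C₂ = .bot ∨ C₄ = .bot) : η ≠ .term ∧ x D .bot := by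
  obtain ⟨k', C₁', ht, -, hD, -⟩ := hm
  obtain ⟨C₂', hw, hR⟩ := h₁ η C₁' ht
  have hbot' : C₂' = .bot ∨ C₄ = .bot := by
    refine hbot.imp_left ?_
    rintro rfl
    exact hw.of_bot.1
  exact ⟨ht.ne_term hD.left_ne_bot, hsep _ _ (utSep_bot hD hR h₂ hbot')⟩

theorem LeftMove.simulated (hm : LeftMove k C₁ C₃ η D) (hx : Tower WP x) (hsep : utSep x ≤ x)
    (h₁ : WP x C₁ C₂) (h₂ : x C₃ C₄) (hd₁ : C₁.envDom = C₂.envDom) (hd₂ : C₃.envDom = C₄.envDom)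
    (hA₁ : C₂.used ⊆ C₁.used) (hA₂ : C₄.used ⊆ C₃.used) (hC' : SepConj .one k C₂ C₄ C') :
    ∃ D', WTrans C' η D' ∧ x D D' := by
  obtain ⟨k', C₁', ht, hk, hD, hn⟩ := hm
  obtain ⟨C₂', hw, hR⟩ := h₁ η C₁' ht
  have hC₁' := hD.left_ne_bot
  have henv₁ := ht.envDom hC₁'
  by_cases hC₂' : C₂' = .bot
  · exact ⟨.bot, .response C' (ht.ne_term hC₁'), hsep _ _ (utSep_bot hD hR h₂ (.inl hC₂'))⟩
  have hh : Disjoint η.holes C₄.envDom :=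
    hd₂ ▸ hD.envDom_disjoint.mono_left (henv₁ ▸ Finset.subset_union_right)
  obtain ⟨ρ, D', hw', hD'⟩ := hC'.exists_wTrans_left_ren hw hC₂' hk hh (hn.mono_right hA₂)
  have henv : C₁'.envDom = (C₂'.ren ρ).envDom := by
    rw [Conf.envDom_ren, henv₁, hw.envDom hC₂', hd₁]
  have hused : (C₂'.ren ρ).used ⊆ C₁'.used := by
    rw [Conf.used_ren, ht.used hC₁', hw.used hC₂']
    exact Set.union_subset_union_left _ hA₁
  exact ⟨D', hw', hsep _ _ (.sep .one k' C₁' (C₂'.ren ρ) C₃ C₄ D D' (hx.ren hR ρ) h₂ henv hd₂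
    hused hA₂ hD hD')⟩

theorem SepConj.WP_bot (hC : SepConj .one k C₁ C₃ C) (hx : Tower WP x) (hsep : utSep x ≤ x)
    (h₁ : WP x C₁ C₂) (h₂ : WP x C₃ C₄) (hbot : C₂ = .bot ∨ C₄ = .bot) : WP x C .bot := by
  have not_term : ∀ {B}, WP x B .bot → ¬ Trans B .term .bot := fun h ht =>
    (h _ _ ht).elim fun _ hw => hw.1.of_bot.2 rfl
  intro η D ht
  rcases hC.trans_cases ht with ⟨rfl, hη⟩ | ⟨-, -, -, ht₁, ht₂⟩ | hm | ⟨-, hm⟩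
  · exact ⟨.bot, .response _ hη, hx.refl _⟩
  · rcases hbot with rfl | rfl
    · exact absurd ht₁ (not_term h₁)
    · exact absurd ht₂ (not_term h₂)
  · obtain ⟨hη, hR⟩ := hm.bot hsep h₁ (hx.map_le WP_mono _ _ h₂) hbot
    exact ⟨.bot, .response _ hη, hR⟩
  · obtain ⟨hη, hR⟩ := hm.bot hsep h₂ (hx.map_le WP_mono _ _ h₁) hbot.symm
    exact ⟨.bot, .response _ hη, hR⟩

theorem SepConj.WP_sep (hC : SepConj .one k C₁ C₃ C) (hx : Tower WP x) (hsep : utSep x ≤ x)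
    (hC' : SepConj .one k C₂ C₄ C') (h₁ : WP x C₁ C₂) (h₂ : WP x C₃ C₄)
    (hd₁ : C₁.envDom = C₂.envDom) (hd₂ : C₃.envDom = C₄.envDom) (hA₁ : C₂.used ⊆ C₁.used)
    (hA₂ : C₄.used ⊆ C₃.used) : WP x C C' := by
  by_cases hopp : C₁.IsOpp ∧ ¬ C₂.IsOpp
  · have hbot : WP x C₁ .bot := WP_bot_of_isOpp hx h₁ hopp.1 hopp.2
    exact WP_of_bot (hC.WP_bot hx hsep hbot h₂ (.inl rfl)) C'
  replace hopp : C₁.IsOpp → C₂.IsOpp := fun h => not_not.1 fun h' => hopp ⟨h, h'⟩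
  intro η D ht
  rcases hC.trans_cases ht with ⟨rfl, hη⟩ | ⟨rfl, rfl, rfl, ht₁, -⟩ | hm | ⟨ho, hm⟩
  · exact ⟨.bot, .response _ hη, hx.refl _⟩
  · have ho : C₁.IsOpp := ht₁.isOpp_of_label trivial (.inr rfl)
    exact ⟨.bot, (hC'.term (hopp ho)).weak, hx.refl _⟩
  · exact hm.simulated hx hsep h₁ (hx.map_le WP_mono _ _ h₂) hd₁ hd₂ hA₁ hA₂ hC'
  · exact hm.simulated hx hsep h₂ (hx.map_le WP_mono _ _ h₁) hd₂ hd₁ hA₂ hA₁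
      (hC'.swap_of_isOpp (hopp ho))

end

theorem Tower.utSep_le {x : CRel O} (h : Tower WP x) : utSep x ≤ x := by
  induction h with
  | sInf X _ ih => exact le_sInf fun x hx => (utSep_mono (sInf_le hx)).trans (ih x hx)
  | step x hx hsep =>
    intro C C' h
    cases h with
    | sep i k C₁ C₂ C₃ C₄ _ _ h₁ h₂ hd₁ hd₂ hA₁ hA₂ hC hC' =>
      cases i with
      | one => exact hC.WP_sep hx hsep hC' h₁ h₂ hd₁ hd₂ hA₁ hA₂
      | two => exact hC.swap.WP_sep hx hsep hC'.swap h₂ h₁ hd₂ hd₁ hA₂ hA₁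
    | botL i k C₁ C₃ C₄ _ h₁ h₂ hC =>
      cases i with
      | one => exact hC.WP_bot hx hsep h₁ h₂ (.inl rfl)
      | two => exact hC.swap.WP_bot hx hsep h₂ h₁ (.inr rfl)
    | botR i k C₁ C₂ C₃ _ h₁ h₂ hC =>
      cases i with
      | one => exact hC.WP_bot hx hsep h₁ h₂ (.inr rfl)
      | two => exact hC.swap.WP_bot hx hsep h₂ h₁ (.inl rfl)

theorem utSep_le_companion : utSep (O := O) ≤ companion :=
  le_companion_of_tower utSep_mono fun _ => Tower.utSep_le

end SepUpTo

theorem mainTheorem2 (O : SepUpTo.OpSig) :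
    Monotone (SepUpTo.utSep (O := O)) ∧
    SepUpTo.IsSoundUpTo (SepUpTo.utSep (O := O)) ∧
    SepUpTo.IsSoundUpTo (fun R : SepUpTo.CRel O => R ⊔ SepUpTo.utSep R) ∧
    SepUpTo.utSep (O := O) ≤ SepUpTo.companion ∧
    ∀ g : SepUpTo.CRel O → SepUpTo.CRel O, g ≤ SepUpTo.companion →
      SepUpTo.IsSoundUpTo (SepUpTo.omegaIter (SepUpTo.utSep ⊔ g)) :=
  ⟨SepUpTo.utSep_mono,
    SepUpTo.isSoundUpTo_companion.anti SepUpTo.utSep_le_companion,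
    SepUpTo.isSoundUpTo_companion.anti
      (sup_le SepUpTo.id_le_companion SepUpTo.utSep_le_companion),
    SepUpTo.utSep_le_companion,
    fun _ hg => SepUpTo.isSoundUpTo_companion.anti
      (SepUpTo.omegaIter_le_companion (sup_le SepUpTo.utSep_le_companion hg))⟩
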